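/- An odd unimodal sequence of size $n$ is a sequence of odd positive integers with a distinguished peak $\bar c$, $$a_1\le\dots\le a_r\le \bar c\ge b_1\ge\dots\ge b_s\qquad(r,s\ge 0),$$ such that $\bar c+\sum_{j=1}^r a_j+\sum_{j=1}^s b_j=n$. For $n\ge 1$ let $\mathbf P_n$ be the uniform probability measure on the finite nonempty set of odd unimodal sequences of size $n$ (two sequences with different distinguished positions being counted as different), let $\mathbf E_n$ be the expectation under $\mathbf P_n$, and let $\mathrm{PK}$ be the value $\bar c$ of the peak. Put $B=\sqrt6/\pi$. **Theorem.** For every $v\in\mathbb R$, $$\lim_{n\to\infty}\mathbf P_n\left(\frac{\mathrm{PK}-B\sqrt n\,\log(2B\sqrt n)}{B\sqrt n}\le v\right)=e^{-\frac12 e^{-v}},$$ and, as $n\to\infty$, $$\mathbf E_n(\mathrm{PK})=B\sqrt n\,\log(2B\sqrt n)+B\sqrt n\,(\gamma-\log 2)\,(1+o(1)),$$ where $\gamma$ is the Euler--Mascheroni constant. -/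

import Mathlib

open MeasureTheory ProbabilityTheory Filter
open scoped Topology

/-- An odd unimodal sequence `a₁ ≤ ⋯ ≤ aᵣ ≤ c̄ ≥ b₁ ≥ ⋯ ≥ bₛ` with a marked peak `c̄`,
all of whose entries are odd positive integers.  Either side of the peak may be empty. -/
@[ext]
structure OddUnimodalSeq where
  /-- the entries `a₁, …, aᵣ` to the left of the peak -/
  left : List ℕ
  /-- the marked peak `c̄` -/
  peak : ℕ
  /-- the entries `b₁, …, bₛ` to the right of the peak -/
  right : List ℕ
  increasing : (left ++ [peak]).Pairwise (· ≤ ·)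
  decreasing : (peak :: right).Pairwise (· ≥ ·)
  odd : ∀ x ∈ left ++ peak :: right, Odd x

namespace OddUnimodalSeq

/-- The size (weight) of an odd unimodal sequence: the sum of all its entries. -/
def size (s : OddUnimodalSeq) : ℕ := s.left.sum + s.peak + s.right.sum

/-- The set of odd unimodal sequences of size `n`. -/
def ofSize (n : ℕ) : Set OddUnimodalSeq := {s | s.size = n}

/-- All sets of odd unimodal sequences are measurable (it is a countable discrete set). -/
instance : MeasurableSpace OddUnimodalSeq := ⊤

instance : DiscreteMeasurableSpace OddUnimodalSeq := ⟨fun _ => trivial⟩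

/-- The uniform probability measure on the odd unimodal sequences of size `n`. -/
noncomputable def uniformMeasure (n : ℕ) : Measure OddUnimodalSeq := uniformOn (ofSize n)

/-- There are only finitely many odd unimodal sequences of size `n`. -/
theorem finite_ofSize (n : ℕ) : (ofSize n).Finite := by
  let f : ofSize n → Composition n × Fin (n + 1) := fun s =>
    let c : Composition n :=
      ⟨s.1.left ++ s.1.peak :: s.1.right, fun hi => (s.1.odd _ hi).pos, by
        have h : s.1.left.sum + s.1.peak + s.1.right.sum = n := s.2
        simp only [List.sum_append, List.sum_cons]; omega⟩
    ⟨c, ⟨s.1.left.length, by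
        have h := c.length_le
        have h' : c.length = s.1.left.length + (s.1.right.length + 1) := by
          simp [c, Composition.length]
        omega⟩⟩
  have hf : Function.Injective f := by
    intro s t h
    simp only [f, Prod.mk.injEq, Composition.mk.injEq, Fin.mk.injEq] at h
    obtain ⟨h₁, h₂⟩ := List.append_inj h.1 h.2
    simp only [List.cons.injEq] at h₂
    exact Subtype.ext (OddUnimodalSeq.ext h₁ h₂.1 h₂.2)
  exact Set.finite_coe_iff.mp (Finite.of_injective f hf)

/-- There is an odd unimodal sequence of each positive size. -/
theorem nonempty_ofSize {n : ℕ} (hn : 1 ≤ n) : (ofSize n).Nonempty := by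
  refine ⟨⟨[], 1, List.replicate (n - 1) 1, by simp, ?_, ?_⟩, ?_⟩
  · rw [← List.replicate_succ]
    simp [List.pairwise_replicate]
  · intro x hx
    have : x = 1 := by
      simp only [List.nil_append, List.mem_cons, List.mem_replicate] at hx
      tauto
    simp [this]
  · simp only [ofSize, size, Set.mem_ofPred_eq, List.sum_nil, List.sum_replicate, smul_eq_mul]
    omega

/-- For `n ≥ 1` the uniform measure is indeed a probability measure. -/
theorem isProbabilityMeasure_uniformMeasure {n : ℕ} (hn : 1 ≤ n) :
    IsProbabilityMeasure (uniformMeasure n) :=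
  isProbabilityMeasure_uniformOn (finite_ofSize n) (nonempty_ofSize hn)

end OddUnimodalSeq

/-! Deleting the marked peak `2i+1` leaves a pair of partitions into odd parts at most `2i+1`. With
`P_I = ∏_{i<I} (1 - q^(2i+1))^(-2)`, the relation `(1 - x)^2 P_{I+1} = P_I`, `x = q^(2I+1)`,
telescopes: twice the number of sequences with peak below `2I` is the number of pairs with all parts
below `2I` plus the number of those pairs whose two largest parts agree (`two_mul_peakCount`). The
second number is negligible (`tendsto_equalCount_div`), so the peak behaves like the largest part of
a random pair.

Pairs are counted by a local limit theorem. On the circle of radius `e^(-w)` the coefficient of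
`q^n` in `P_I` is `P_I(e^(-w)) e^(nw)` times the probability that a sum of independent geometric
multiplicities, weighted by the parts, equals `n`. The choice `w = δ^2 = π/√(6n)` places the mean at
`n + O(1/w)`, because `∫ x/(e^x - 1) = π^2/6` (`abs_mean_sub_le`); the variance has order `δ^(-6)`,
so the probability has order `δ^3`. Its rescaling `normCount` is bounded above, bounded below
(`eventually_le_normCount`), and changes by `o(1)` when parts from `2I+1` on are forbidden, as long
as `e^(-2Iw) = O(w)` (`tendsto_normCount_sub`). No asymptotic formula for the counts is needed:
their ratio is asymptotic to the ratio of generating functions, `∏_{I≤i<n} (1 - e^(-(2i+1)w))^2 ≈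
exp(-e^(-2Iw)/w)`, which at `2Iw = log(2/w) + v` tends to `exp(-e^(-v)/2)`.

For the mean, both tails of the rescaled peak are dominated by a constant times `e^(-t)`, uniformly
in `n` (`eventually_one_sub_peakCount_div_le`, `eventually_peakCount_div_le`), so expectations
converge to the mean of the limit law. That law is the law of `-log(2X)` with `X` standard
exponential, and `E log X = Γ'(1) = -γ`. -/

/-! ### Generating functions of partitions into odd parts -/

/-- The power series `∑ X ^ (k * j) = 1 / (1 - X ^ k)` with natural number coefficients. -/
noncomputable def geomSeries (k : ℕ) : PowerSeries ℕ :=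
  PowerSeries.mk fun n => if k ∣ n then 1 else 0

/-- The generating function of partitions into odd parts less than `2 * I`. -/
noncomputable def oddSeries (I : ℕ) : PowerSeries ℕ := ∏ i ∈ Finset.range I, geomSeries (2 * i + 1)

/-- The generating function of pairs of partitions into odd parts less than `2 * I`. -/
noncomputable def pairSeries (I : ℕ) : PowerSeries ℕ := oddSeries I * oddSeries I

/-- The number of pairs of partitions into odd parts less than `2 * I`, of total size `n`. -/
noncomputable def pairCount (I n : ℕ) : ℕ := PowerSeries.coeff n (pairSeries I)

lemma geomSeries_eq {k : ℕ} (hk : 0 < k) :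
    geomSeries k = 1 + PowerSeries.X ^ k * geomSeries k := by
  ext n
  simp only [geomSeries, PowerSeries.coeff_mk, map_add, PowerSeries.coeff_one,
    PowerSeries.coeff_X_pow_mul']
  rcases Nat.eq_zero_or_pos n with rfl | hn
  · simp [hk.ne']
  · by_cases h : k ≤ n
    · have h' : k ∣ n ∨ n ≤ k ↔ k ∣ n :=
        ⟨fun hd => hd.elim id fun h2 => (le_antisymm h h2) ▸ dvd_rfl, Or.inl⟩
      simp [h, hn.ne', Nat.dvd_sub_self_right, h']
    · have : ¬ k ∣ n := fun hd => h (Nat.le_of_dvd hn hd)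
      simp [h, hn.ne', this]

/-- Either the part `2I+1` is absent, or one copy of it can be removed. Coefficients lie in `ℕ`, so
all such identities are kept free of subtraction. -/
lemma oddSeries_succ (I : ℕ) :
    oddSeries (I + 1) = oddSeries I + PowerSeries.X ^ (2 * I + 1) * oddSeries (I + 1) := by
  have h : oddSeries (I + 1) = oddSeries I * geomSeries (2 * I + 1) := by
    simp [oddSeries, Finset.prod_range_succ]
  conv_lhs => rw [h, geomSeries_eq (by omega)]
  rw [h]; ring

/-- Weakly decreasing lists of odd numbers less than `2 * I` with sum `n`. -/
def oddLists (I n : ℕ) : Set (List ℕ) :=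
  {l | l.Pairwise (· ≥ ·) ∧ (∀ x ∈ l, Odd x ∧ x < 2 * I) ∧ l.sum = n}

lemma oddLists_zero (n : ℕ) : oddLists 0 n = if n = 0 then {[]} else ∅ := by
  ext l
  rcases l with _ | ⟨a, l⟩
  · by_cases h : n = 0 <;> simp [oddLists, h, eq_comm]
  · have : (a :: l) ∉ oddLists 0 n := fun h => by
      have := (h.2.1 a (by simp)).2
      omega
    by_cases h : n = 0 <;> simp [h] at this ⊢ <;> exact this

/-- A weakly decreasing list contains `2I+1` only if it starts with it. This is the list form of
`oddSeries_succ`, so the counts agree by induction. -/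
lemma oddLists_succ (I n : ℕ) :
    oddLists (I + 1) n = oddLists I n ∪
      (if 2 * I + 1 ≤ n then (List.cons (2 * I + 1)) '' oddLists (I + 1) (n - (2 * I + 1))
        else ∅) := by
  ext l
  rcases l with _ | ⟨a, l⟩
  · split_ifs <;> simp [oddLists]
  · constructor
    · rintro ⟨h1, h2, h3⟩
      have ha := h2 a (by simp)
      rw [List.pairwise_cons] at h1
      rw [List.sum_cons] at h3
      by_cases hlt : a < 2 * I
      · left
        refine ⟨List.pairwise_cons.2 h1, fun x hx => ⟨(h2 x hx).1, ?_⟩, by simpa using h3⟩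
        rcases List.mem_cons.1 hx with rfl | hx
        · exact hlt
        · exact (h1.1 x hx).trans_lt hlt
      · have haI : a = 2 * I + 1 := by
          obtain ⟨⟨b, hb⟩, h⟩ := ha; omega
        right
        rw [if_pos (by omega)]
        exact ⟨l, ⟨h1.2, fun x hx => h2 x (by simp [hx]), by omega⟩, by rw [haI]⟩
    · rintro (⟨h1, h2, h3⟩ | h)
      · exact ⟨h1, fun x hx => ⟨(h2 x hx).1, (h2 x hx).2.trans (by omega)⟩, h3⟩
      · split_ifs at h with hn
        · obtain ⟨l', ⟨h1, h2, h3⟩, h⟩ := h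
          rw [← h]
          refine ⟨List.pairwise_cons.2 ⟨fun x hx => ?_, h1⟩, fun x hx => ?_, ?_⟩
          · have := h2 x hx; omega
          · rcases List.mem_cons.1 hx with rfl | hx
            · exact ⟨⟨I, rfl⟩, by omega⟩
            · exact h2 x hx
          · rw [List.sum_cons, h3]; omega
        · exact absurd h (Set.notMem_empty _)

lemma finite_oddLists (I n : ℕ) : (oddLists I n).Finite := by
  induction I generalizing n with
  | zero => rw [oddLists_zero]; split_ifs <;> simp
  | succ I ih =>
    induction n using Nat.strong_induction_on with
    | _ n ihn =>
      rw [oddLists_succ]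
      refine (ih n).union ?_
      split_ifs with h
      · exact (ihn _ (by omega)).image _
      · exact Set.finite_empty

lemma ncard_oddLists (I n : ℕ) : (oddLists I n).ncard = PowerSeries.coeff n (oddSeries I) := by
  induction I generalizing n with
  | zero =>
    rw [oddLists_zero]
    by_cases h : n = 0 <;> simp [oddSeries, PowerSeries.coeff_one, h]
  | succ I ih =>
    induction n using Nat.strong_induction_on with
    | _ n ihn =>
      rw [oddLists_succ, oddSeries_succ, map_add, PowerSeries.coeff_X_pow_mul', ← ih]
      split_ifs with h
      · rw [Set.ncard_union_eq _ (finite_oddLists _ _) ((finite_oddLists _ _).image _),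
          Set.ncard_image_of_injective _ List.cons_injective, ihn _ (by omega)]
        rw [Set.disjoint_left]
        rintro l ⟨-, h2, -⟩ ⟨l', -, rfl⟩
        have := (h2 (2 * I + 1) (by simp)).2
        omega
      · simp

/-! ### Sequences with a given peak -/

namespace OddUnimodalSeq

/-- Deleting the peak is a bijection onto pairs of partitions with parts at most `2i+1`; the left
side is reversed so that both lists decrease. -/
lemma ncard_size_peak (i n : ℕ) :
    {s ∈ ofSize n | s.peak = 2 * i + 1}.ncard =
      if 2 * i + 1 ≤ n then pairCount (i + 1) (n - (2 * i + 1)) else 0 := by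
  split_ifs with hn
  · have key : {s ∈ ofSize n | s.peak = 2 * i + 1}.ncard =
        ((Finset.sigma (Finset.HasAntidiagonal.antidiagonal (n - (2 * i + 1))) fun p =>
          (finite_oddLists (i + 1) p.1).toFinset ×ˢ
            (finite_oddLists (i + 1) p.2).toFinset :
            Finset (Σ _ : ℕ × ℕ, List ℕ × List ℕ)) :
            Set (Σ _ : ℕ × ℕ, List ℕ × List ℕ)).ncard := by
      refine Set.ncard_congr (fun s _ => ⟨(s.left.sum, s.right.sum), (s.left.reverse, s.right)⟩)
        ?_ ?_ ?_
      · rintro s ⟨hs, hp⟩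
        have hs' : s.left.sum + s.peak + s.right.sum = n := hs
        have hi := List.pairwise_append.1 s.increasing
        have hd := List.pairwise_cons.1 s.decreasing
        simp only [Finset.coe_sigma, Set.mem_sigma_iff, Finset.mem_coe,
          Finset.HasAntidiagonal.mem_antidiagonal, Finset.mem_product, Set.Finite.mem_toFinset]
        refine ⟨by omega, ⟨?_, ?_, by simp⟩, hd.2, ?_, rfl⟩
        · exact List.pairwise_reverse.2 hi.1
        · intro x hx
          have hx := List.mem_reverse.1 hx
          have := hi.2.2 x hx s.peak (by simp)
          exact ⟨s.odd x (by simp [hx]), by omega⟩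
        · intro x hx
          have := hd.1 x hx
          exact ⟨s.odd x (by simp [hx]), by omega⟩
      · rintro s t ⟨-, hs⟩ ⟨-, ht⟩ h
        simp only [Sigma.mk.injEq, heq_eq_eq, Prod.mk.injEq, List.reverse_inj] at h
        exact OddUnimodalSeq.ext h.2.1 (hs.trans ht.symm) h.2.2
      · rintro ⟨⟨a, b⟩, l, r⟩ h
        simp only [Finset.coe_sigma, Set.mem_sigma_iff, Finset.mem_coe,
          Finset.HasAntidiagonal.mem_antidiagonal, Finset.mem_product, Set.Finite.mem_toFinset] at h
        obtain ⟨hab, ⟨hl1, hl2, hl3⟩, hr1, hr2, hr3⟩ := h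
        refine ⟨⟨l.reverse, 2 * i + 1, r, ?_, ?_, ?_⟩, ⟨?_, rfl⟩, ?_⟩
        · refine List.pairwise_append.2 ⟨List.pairwise_reverse.2 hl1, by simp, ?_⟩
          intro x hx y hy
          have := hl2 x (List.mem_reverse.1 hx)
          simp only [List.mem_singleton] at hy
          omega
        · refine List.pairwise_cons.2 ⟨fun x hx => ?_, hr1⟩
          have := hr2 x hx
          omega
        · intro x hx
          simp only [List.mem_append, List.mem_reverse, List.mem_cons] at hx
          rcases hx with hx | rfl | hx
          · exact (hl2 x hx).1
          · exact ⟨i, rfl⟩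
          · exact (hr2 x hx).1
        · simp only [ofSize, size, Set.mem_ofPred_eq, List.sum_reverse, hl3, hr3]
          omega
        · simp [hl3, hr3]
    rw [key, Set.ncard_coe_finset, Finset.card_sigma, pairCount, pairSeries,
      PowerSeries.coeff_mul]
    refine Finset.sum_congr rfl fun p _ => ?_
    rw [Finset.card_product, ← ncard_oddLists, ← ncard_oddLists,
      Set.ncard_eq_toFinset_card _ (finite_oddLists _ _),
      Set.ncard_eq_toFinset_card _ (finite_oddLists _ _)]
  · rw [Set.ncard_eq_zero ((finite_ofSize n).subset fun s hs => hs.1)]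
    ext s
    simp only [Set.mem_ofPred_eq, Set.mem_empty_iff_false, iff_false, not_and]
    intro hs
    have hs' : s.left.sum + s.peak + s.right.sum = n := hs
    omega

end OddUnimodalSeq

/-! ### Recursion in the largest part, and peaks against pairs -/

/-- This is `(1 - x)^2 P_{I+1} = P_I` with `x = X^(2I+1)`, the negative term moved across. -/
lemma pairSeries_succ (I : ℕ) :
    pairSeries (I + 1) + PowerSeries.X ^ (2 * (2 * I + 1)) * pairSeries (I + 1) =
      pairSeries I + 2 * (PowerSeries.X ^ (2 * I + 1) * pairSeries (I + 1)) := by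
  have h := oddSeries_succ I
  set x : PowerSeries ℕ := PowerSeries.X ^ (2 * I + 1)
  have hx : (PowerSeries.X : PowerSeries ℕ) ^ (2 * (2 * I + 1)) = x * x := by
    simp only [x]; ring
  rw [hx]
  simp only [pairSeries]
  set a := oddSeries (I + 1)
  set b := oddSeries I
  have e1 : a * a = b * a + x * a * a := by
    calc a * a = (b + x * a) * a := by rw [← h]
      _ = _ := by ring
  have e2 : b * a = b * b + x * (b * a) := by
    calc b * a = b * (b + x * a) := by rw [← h]
      _ = _ := by ring
  have e3 : x * (b * a) + x * x * (a * a) = x * a * a := by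
    calc x * (b * a) + x * x * (a * a) = x * a * (b + x * a) := by ring
      _ = _ := by rw [← h]
  calc a * a + x * x * (a * a) = b * b + (x * (b * a) + x * x * (a * a)) + x * a * a := by
        rw [← add_assoc, ← e2, add_right_comm, ← e1]
    _ = b * b + 2 * (x * (a * a)) := by rw [e3]; ring

/-- `pairCount I (n - k)` for `k ≤ n`, and `0` otherwise. -/
noncomputable def shiftCount (I n k : ℕ) : ℕ := if k ≤ n then pairCount I (n - k) else 0

lemma coeff_X_pow_mul_pairSeries (I n k : ℕ) :
    PowerSeries.coeff n (PowerSeries.X ^ k * pairSeries I) = shiftCount I n k := by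
  rw [PowerSeries.coeff_X_pow_mul', shiftCount, pairCount]

lemma pairCount_succ (I n : ℕ) :
    pairCount (I + 1) n + shiftCount (I + 1) n (2 * (2 * I + 1)) =
      pairCount I n + 2 * shiftCount (I + 1) n (2 * I + 1) := by
  have h := congrArg (PowerSeries.coeff n) (pairSeries_succ I)
  simp only [map_add, coeff_X_pow_mul_pairSeries, two_mul (PowerSeries.X ^ _ * _)] at h
  simp only [pairCount, two_mul (shiftCount _ _ _)]
  exact h

/-- One factor of `P_{I+1}` is expanded by `oddSeries_succ`: the difference of the two sides is a
coefficient of a series over `ℕ`. Combined with `pairCount_succ` it gives monotonicity in `I`. -/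
lemma shiftCount_two_mul_le (I n : ℕ) :
    shiftCount (I + 1) n (2 * (2 * I + 1)) ≤ shiftCount (I + 1) n (2 * I + 1) := by
  have h : PowerSeries.X ^ (2 * I + 1) * pairSeries (I + 1) =
      PowerSeries.X ^ (2 * I + 1) * (oddSeries I * oddSeries (I + 1)) +
        PowerSeries.X ^ (2 * (2 * I + 1)) * pairSeries (I + 1) := by
    calc PowerSeries.X ^ (2 * I + 1) * pairSeries (I + 1)
        = PowerSeries.X ^ (2 * I + 1) * ((oddSeries I + PowerSeries.X ^ (2 * I + 1) *
            oddSeries (I + 1)) * oddSeries (I + 1)) := by rw [← oddSeries_succ]; rfl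
      _ = _ := by simp only [pairSeries]; ring
  have h' := congrArg (PowerSeries.coeff n) h
  rw [map_add, coeff_X_pow_mul_pairSeries, coeff_X_pow_mul_pairSeries] at h'
  omega

lemma pairCount_add_shiftCount_le (I n : ℕ) :
    pairCount I n + shiftCount (I + 1) n (2 * I + 1) ≤ pairCount (I + 1) n := by
  have h := pairCount_succ I n
  have := shiftCount_two_mul_le I n
  omega

lemma pairCount_mono (n : ℕ) : Monotone fun I => pairCount I n :=
  monotone_nat_of_le_succ fun I => by have := pairCount_add_shiftCount_le I n; omega

lemma pairCount_zero {n : ℕ} (hn : 1 ≤ n) : pairCount 0 n = 0 := by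
  simp [pairCount, pairSeries, oddSeries, PowerSeries.coeff_one]; omega

/-- The number of pairs of partitions of total size `n` with the same largest part, which is
odd and less than `2 * I`. -/
noncomputable def equalCount (I n : ℕ) : ℕ :=
  ∑ i ∈ Finset.range I, shiftCount (i + 1) n (2 * (2 * i + 1))

/-- The number of odd unimodal sequences of size `n` with peak less than `2 * I`. -/
noncomputable def peakCount (I n : ℕ) : ℕ :=
  ∑ i ∈ Finset.range I, shiftCount (i + 1) n (2 * i + 1)

/-- Inclusion–exclusion on which component of the pair attains the overall largest part, obtained by
telescoping `pairCount_succ`. The assumption `1 ≤ n` discards the empty pair. -/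
lemma two_mul_peakCount {n : ℕ} (hn : 1 ≤ n) (I : ℕ) :
    2 * peakCount I n = pairCount I n + equalCount I n := by
  induction I with
  | zero => simp [peakCount, equalCount, pairCount_zero hn]
  | succ I ih =>
    have h := pairCount_succ I n
    simp only [peakCount, equalCount, Finset.sum_range_succ] at ih ⊢
    omega

lemma peakCount_le (n I : ℕ) : peakCount I n ≤ pairCount I n := by
  induction I with
  | zero => simp [peakCount]
  | succ I ih =>
    have h := pairCount_add_shiftCount_le I n
    simp only [peakCount, Finset.sum_range_succ] at ih ⊢
    omega

/-! ### The distribution of the peak as a quotient of counts -/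

namespace OddUnimodalSeq

lemma ncard_size_peak_lt (I n : ℕ) : {s ∈ ofSize n | s.peak < 2 * I}.ncard = peakCount I n := by
  induction I with
  | zero => simp [peakCount]
  | succ I ih =>
    have hu : {s ∈ ofSize n | s.peak < 2 * (I + 1)} =
        {s ∈ ofSize n | s.peak < 2 * I} ∪ {s ∈ ofSize n | s.peak = 2 * I + 1} := by
      ext s
      have := s.odd s.peak (by simp)
      simp only [Set.mem_ofPred_eq, Set.mem_union]
      rcases this with ⟨k, hk⟩
      constructor
      · rintro ⟨h1, h2⟩
        by_cases h : s.peak < 2 * I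
        · exact Or.inl ⟨h1, h⟩
        · exact Or.inr ⟨h1, by omega⟩
      · rintro (⟨h1, h2⟩ | ⟨h1, h2⟩) <;> exact ⟨h1, by omega⟩
    rw [hu, Set.ncard_union_eq _ ((finite_ofSize n).subset fun s hs => hs.1)
      ((finite_ofSize n).subset fun s hs => hs.1), ih, ncard_size_peak, peakCount,
      peakCount, Finset.sum_range_succ, shiftCount]
    rw [Set.disjoint_left]
    rintro s ⟨-, h⟩ ⟨-, h'⟩
    omega

lemma ncard_ofSize (n : ℕ) : (ofSize n).ncard = peakCount n n := by
  rw [← ncard_size_peak_lt]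
  refine congrArg Set.ncard (Set.ext fun s => ?_)
  simp only [Set.mem_ofPred_eq]
  refine ⟨fun hs => ⟨hs, ?_⟩, fun hs => hs.1⟩
  have hs' : s.left.sum + s.peak + s.right.sum = n := hs
  have := (s.odd s.peak (by simp)).pos
  omega

lemma uniformMeasure_real_eq (n : ℕ) (S : Set OddUnimodalSeq) :
    (uniformMeasure n).real S = ({s ∈ ofSize n | s ∈ S}.ncard : ℝ) / (ofSize n).ncard := by
  classical
  have hf := finite_ofSize n
  rw [uniformMeasure, measureReal_def, ← uniformOn_inter_self hf]
  have hf' : (ofSize n ∩ S).Finite := hf.subset Set.inter_subset_left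
  have h : ((uniformOn (ofSize n)) (ofSize n ∩ S)) =
      (hf'.toFinset.card : ENNReal) / hf.toFinset.card := by
    have := uniformOn_apply_finset (s := hf.toFinset) (t := hf'.toFinset)
    rw [Set.Finite.coe_toFinset, Set.Finite.coe_toFinset] at this
    rw [this]
    congr 3
    ext; simp
  rw [h, ENNReal.toReal_div, ENNReal.toReal_natCast, ENNReal.toReal_natCast,
    Set.ncard_eq_toFinset_card _ hf]
  congr 2
  rw [← Set.ncard_eq_toFinset_card _ hf']
  rfl

/-- The number of odd positive integers that are at most `y`. -/
noncomputable def oddIndex (y : ℝ) : ℕ := ⌊(y + 1) / 2⌋₊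

lemma uniformMeasure_real_peak_le {n : ℕ} {y : ℝ} :
    (uniformMeasure n).real {s | (s.peak : ℝ) ≤ y} = (peakCount (oddIndex y) n : ℝ) /
      peakCount n n := by
  rw [uniformMeasure_real_eq, ncard_ofSize, ← ncard_size_peak_lt (oddIndex y)]
  refine congrArg (fun m : ℕ => (m : ℝ) / _) (congrArg Set.ncard (Set.ext fun s => ?_))
  simp only [Set.mem_ofPred_eq, and_congr_right_iff]
  intro hs
  obtain ⟨k, hk⟩ := s.odd s.peak (by simp)
  -- Since `k + 1 ≠ 0`, the floor criterion needs no sign condition, so negative `y` is covered.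
  rw [oddIndex, hk, show 2 * k + 1 < 2 * ⌊(y + 1) / 2⌋₊ ↔ k + 1 ≤ ⌊(y + 1) / 2⌋₊ by omega,
    Nat.le_floor_iff' (by omega)]
  push_cast
  constructor <;> intro h <;> linarith

end OddUnimodalSeq

/-! ### The Fourier integral for the number of pairs of partitions -/

/-- `HasEval f z v`: the power series `f` converges absolutely at `z`, with value `v`. -/
def HasEval (f : PowerSeries ℕ) (z v : ℂ) : Prop :=
  (Summable fun n => ‖((PowerSeries.coeff n f : ℕ) : ℂ) * z ^ n‖) ∧
    HasSum (fun n => ((PowerSeries.coeff n f : ℕ) : ℂ) * z ^ n) v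

lemma HasEval.mul {f g : PowerSeries ℕ} {z v w : ℂ} (hf : HasEval f z v) (hg : HasEval g z w) :
    HasEval (f * g) z (v * w) := by
  have h : (fun n => ((PowerSeries.coeff n (f * g) : ℕ) : ℂ) * z ^ n) = fun n =>
      ∑ p ∈ Finset.HasAntidiagonal.antidiagonal n, (((PowerSeries.coeff p.1 f : ℕ) : ℂ) * z ^ p.1) *
        (((PowerSeries.coeff p.2 g : ℕ) : ℂ) * z ^ p.2) := by
    funext n
    rw [PowerSeries.coeff_mul, Nat.cast_sum, Finset.sum_mul]
    refine Finset.sum_congr rfl fun p hp => ?_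
    rw [← Finset.HasAntidiagonal.mem_antidiagonal.1 hp, pow_add]
    push_cast
    ring
  have hs := summable_norm_sum_mul_antidiagonal_of_summable_norm hf.1 hg.1
  refine ⟨hs.congr fun n => congrArg norm (congrFun h n).symm, ?_⟩
  rw [h, ← hf.2.tsum_eq, ← hg.2.tsum_eq,
    tsum_mul_tsum_eq_tsum_sum_antidiagonal_of_summable_norm hf.1 hg.1]
  exact hs.of_norm.hasSum

lemma hasEval_one (z : ℂ) : HasEval 1 z 1 := by
  have h : (fun n => ((PowerSeries.coeff n (1 : PowerSeries ℕ) : ℕ) : ℂ) * z ^ n) =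
      fun n => if n = 0 then 1 else 0 := by
    funext n
    by_cases hn : n = 0 <;> simp [PowerSeries.coeff_one, hn]
  refine ⟨?_, by rw [h]; exact hasSum_ite_eq 0 1⟩
  refine summable_of_ne_finset_zero (s := {0}) fun n hn => ?_
  rw [congrFun h n, if_neg (by simpa using hn), norm_zero]

lemma hasEval_prod {ι : Type*} (s : Finset ι) {f : ι → PowerSeries ℕ} {z : ℂ} {v : ι → ℂ}
    (h : ∀ i ∈ s, HasEval (f i) z (v i)) : HasEval (∏ i ∈ s, f i) z (∏ i ∈ s, v i) := by
  classical
  induction s using Finset.induction_on with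
  | empty => simpa using hasEval_one z
  | insert a s ha ih =>
    rw [Finset.prod_insert ha, Finset.prod_insert ha]
    exact (h a (by simp)).mul (ih fun i hi => h i (by simp [hi]))

lemma hasEval_geomSeries {k : ℕ} (hk : 0 < k) {z : ℂ} (hz : ‖z‖ < 1) :
    HasEval (geomSeries k) z (1 - z ^ k)⁻¹ := by
  have hinj : Function.Injective fun j : ℕ => k * j := fun a b h => Nat.eq_of_mul_eq_mul_left hk h
  have hzero : ∀ n ∉ Set.range fun j : ℕ => k * j,
      ((PowerSeries.coeff n (geomSeries k) : ℕ) : ℂ) * z ^ n = 0 := by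
    intro n hn
    have : ¬ k ∣ n := fun ⟨j, hj⟩ => hn ⟨j, hj.symm⟩
    simp [geomSeries, this]
  have hcomp : (fun n => ((PowerSeries.coeff n (geomSeries k) : ℕ) : ℂ) * z ^ n) ∘ (fun j => k * j) =
      fun j => (z ^ k) ^ j := by
    funext j
    simp [geomSeries, pow_mul]
  have hzk : ‖z ^ k‖ < 1 := by
    rw [norm_pow]
    exact pow_lt_one₀ (norm_nonneg _) hz hk.ne'
  constructor
  · rw [← hinj.summable_iff (fun n hn => by rw [hzero n hn, norm_zero])]
    have : (fun n => ‖((PowerSeries.coeff n (geomSeries k) : ℕ) : ℂ) * z ^ n‖) ∘ (fun j => k * j) =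
        fun j => ‖(z ^ k) ^ j‖ := by
      funext j
      exact congrArg norm (congrFun hcomp j)
    rw [this]
    exact summable_norm_geometric_of_norm_lt_one hzk
  · rw [← hinj.hasSum_iff hzero, hcomp]
    exact hasSum_geometric_of_norm_lt_one hzk

lemma hasEval_pairSeries (I : ℕ) {z : ℂ} (hz : ‖z‖ < 1) :
    HasEval (pairSeries I) z (∏ i ∈ Finset.range I, ((1 - z ^ (2 * i + 1))⁻¹) ^ 2) := by
  have h := hasEval_prod (Finset.range I) (f := fun i => geomSeries (2 * i + 1))
    (z := z) fun i _ => hasEval_geomSeries (by omega) hz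
  simpa only [pairSeries, oddSeries, sq, Finset.prod_mul_distrib] using h.mul h

/-- The occupation number `1 / (e ^ x - 1)`. -/
noncomputable def bose (x : ℝ) : ℝ := (Real.exp x - 1)⁻¹

/-- The value at `e ^ (-w)` of the generating function of pairs of partitions into odd parts less
than `2 * I`. -/
noncomputable def pairVal (w : ℝ) (I : ℕ) : ℝ :=
  ∏ i ∈ Finset.range I, ((1 - Real.exp (-((2 * i + 1) * w)))⁻¹) ^ 2

/-- The characteristic function of the size of a random pair of partitions into odd parts less
than `2 * I`, where pairs of size `n` have weight `e ^ (-n * w)`. -/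
noncomputable def pairChar (w : ℝ) (I : ℕ) (θ : ℝ) : ℂ :=
  ∏ i ∈ Finset.range I,
    ((1 - (bose ((2 * i + 1) * w) : ℂ) * (Complex.exp (((2 * i + 1) * θ : ℝ) * Complex.I) - 1))⁻¹) ^ 2

lemma pairVal_pos {w : ℝ} (hw : 0 < w) (I : ℕ) : 0 < pairVal w I := by
  refine Finset.prod_pos fun i _ => pow_pos (inv_pos.2 ?_) 2
  rw [sub_pos, Real.exp_lt_one_iff, neg_lt_zero]
  positivity

lemma bose_pos {x : ℝ} (hx : 0 < x) : 0 < bose x :=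
  inv_pos.2 (sub_pos.2 (Real.one_lt_exp_iff.2 hx))

/-- For `p = e^(-kw)` one has `1 - p e^(ikθ) = (1 - p)(1 - m (e^(ikθ) - 1))` with `m = p/(1 - p)`,
the mean of the geometric multiplicity of the part `k`. -/
lemma prod_eq_pairVal_mul_pairChar {w : ℝ} (hw : 0 < w) (I : ℕ) (θ : ℝ) :
    ∏ i ∈ Finset.range I, ((1 - Complex.exp (-w + θ * Complex.I) ^ (2 * i + 1))⁻¹) ^ 2 =
      (pairVal w I : ℂ) * pairChar w I θ := by
  rw [pairVal, pairChar, Complex.ofReal_prod, ← Finset.prod_mul_distrib]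
  refine Finset.prod_congr rfl fun i _ => ?_
  have hx : 0 < (2 * i + 1 : ℝ) * w := by positivity
  have e1 : Complex.exp (-w + θ * Complex.I) ^ (2 * i + 1) =
      (Real.exp (-((2 * i + 1) * w)) : ℂ) * Complex.exp (((2 * i + 1) * θ : ℝ) * Complex.I) := by
    rw [← Complex.exp_nat_mul, Complex.ofReal_exp, ← Complex.exp_add]
    congr 1
    push_cast
    ring
  have e2 : (bose ((2 * i + 1) * w)) = Real.exp (-((2 * i + 1) * w)) /
      (1 - Real.exp (-((2 * i + 1) * w))) := by
    rw [bose, Real.exp_neg]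
    have := Real.exp_pos ((2 * i + 1) * w)
    have : Real.exp ((2 * i + 1) * w) - 1 ≠ 0 := (sub_pos.2 (Real.one_lt_exp_iff.2 hx)).ne'
    field_simp
  have hp : 1 - Real.exp (-((2 * i + 1) * w)) ≠ 0 := by
    exact (sub_pos.2 (Real.exp_lt_one_iff.2 (by linarith))).ne'
  rw [e1, e2]
  set p := Real.exp (-((2 * i + 1) * w))
  set E := Complex.exp (((2 * i + 1) * θ : ℝ) * Complex.I)
  have hp' : (1 - p : ℂ) ≠ 0 := by exact_mod_cast hp
  push_cast
  rw [← mul_pow, ← mul_inv]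
  congr 2
  field_simp
  ring

open Complex in
lemma integral_exp_int_mul (k : ℤ) :
    ∫ θ in (-Real.pi)..Real.pi, exp ((k * θ : ℝ) * I) = if k = 0 then (2 * Real.pi : ℂ) else 0 := by
  split_ifs with h
  · subst h
    simp
    ring
  · have hk : (k * I : ℂ) ≠ 0 := by simp [h]
    have : (fun θ : ℝ => exp ((k * θ : ℝ) * I)) = fun θ : ℝ => exp ((k * I) * θ) := by
      funext θ; push_cast; ring_nf
    rw [this, integral_exp_mul_complex hk]
    have h2 : exp (k * I * (Real.pi : ℝ)) = exp (k * I * ((-Real.pi : ℝ) : ℂ)) := by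
      rw [Complex.exp_eq_exp_iff_exists_int]
      exact ⟨k, by push_cast; ring⟩
    rw [h2, sub_self, zero_div]

/-- Cauchy's coefficient formula on the circle of radius `e^(-w)`: integrate the power series
termwise and use orthogonality of the characters. -/
lemma pairCount_eq_integral {w : ℝ} (hw : 0 < w) (I N : ℕ) :
    ((pairCount I N * Real.exp (-(N * w)) / pairVal w I : ℝ) : ℂ) * (2 * Real.pi) =
      ∫ θ in (-Real.pi)..Real.pi, pairChar w I θ * Complex.exp (-(N * θ : ℝ) * Complex.I) := by
  have hv := (pairVal_pos hw I).ne'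
  have hz : ∀ θ : ℝ, ‖Complex.exp (-w + θ * Complex.I)‖ = Real.exp (-w) := fun θ => by
    rw [Complex.norm_exp]; simp
  have hz1 : ∀ θ : ℝ, ‖Complex.exp (-w + θ * Complex.I)‖ < 1 := fun θ => by
    rw [hz]; simpa using hw
  have hE := fun θ => hasEval_pairSeries I (hz1 θ)
  have hs : HasSum (fun n => ∫ θ in (-Real.pi)..Real.pi,
      (pairCount I n : ℂ) * Complex.exp (-w + θ * Complex.I) ^ n *
        Complex.exp (-(N * θ : ℝ) * Complex.I))
      (∫ θ in (-Real.pi)..Real.pi, (pairVal w I : ℂ) * pairChar w I θ *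
        Complex.exp (-(N * θ : ℝ) * Complex.I)) := by
    refine intervalIntegral.hasSum_integral_of_dominated_convergence
      -- The norm of each term does not depend on `θ`, so its value at `θ = 0` dominates.
      (fun n _ => ‖(pairCount I n : ℂ) * Complex.exp (-w + (0 : ℝ) * Complex.I) ^ n‖) ?_ ?_ ?_ ?_ ?_
    · intro n
      exact Continuous.aestronglyMeasurable (by fun_prop)
    · intro n
      refine Eventually.of_forall fun θ _ => le_of_eq ?_
      rw [norm_mul, norm_mul, norm_mul, norm_pow, norm_pow, hz, hz]
      have : ‖Complex.exp (-(N * θ : ℝ) * Complex.I)‖ = 1 := by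
        rw [← Complex.ofReal_neg, Complex.norm_exp_ofReal_mul_I]
      rw [this, mul_one]
    · exact Eventually.of_forall fun θ _ => (hE 0).1
    · exact intervalIntegrable_const
    · refine Eventually.of_forall fun θ _ => ?_
      rw [← prod_eq_pairVal_mul_pairChar hw]
      have h3 := (hE θ).2.mul_right (Complex.exp (-(N * θ : ℝ) * Complex.I))
      simpa only [pairCount] using h3
  set A : ℂ := ((pairCount I N * Real.exp (-(N * w)) : ℝ) : ℂ) * (2 * Real.pi) with hA
  have hterm : ∀ n, ∫ θ in (-Real.pi)..Real.pi,
      (pairCount I n : ℂ) * Complex.exp (-w + θ * Complex.I) ^ n *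
        Complex.exp (-(N * θ : ℝ) * Complex.I) =
      if n = N then A else 0 := by
    intro n
    have : (fun θ : ℝ => (pairCount I n : ℂ) * Complex.exp (-w + θ * Complex.I) ^ n *
        Complex.exp (-(N * θ : ℝ) * Complex.I)) = fun θ : ℝ =>
        ((pairCount I n * Real.exp (-(n * w)) : ℝ) : ℂ) *
          Complex.exp ((((n : ℤ) - N : ℤ) * θ : ℝ) * Complex.I) := by
      funext θ
      rw [Complex.ofReal_mul (pairCount I n : ℝ), Complex.ofReal_exp, Complex.ofReal_natCast,
        mul_assoc, mul_assoc,
        ← Complex.exp_nat_mul, ← Complex.exp_add, ← Complex.exp_add]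
      congr 2
      push_cast
      ring
    rw [this, intervalIntegral.integral_const_mul, integral_exp_int_mul]
    by_cases h : n = N
    · subst h; simp [hA]
    · have : ((n : ℤ) - N : ℤ) ≠ 0 := by omega
      rw [if_neg this, if_neg h, mul_zero]
  have h2 := (hs.congr_fun fun n => (hterm n).symm).unique (hasSum_ite_eq N A)
  simp_rw [mul_assoc (pairVal w I : ℂ)] at h2
  rw [intervalIntegral.integral_const_mul] at h2
  have hv' : (pairVal w I : ℂ) ≠ 0 := by exact_mod_cast hv
  rw [Complex.ofReal_div, div_mul_eq_mul_div, ← hA, ← h2, mul_div_cancel_left₀ _ hv']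

/-- The integrand of the rescaled Fourier integral. -/
noncomputable def fourierKernel (w s : ℝ) (I N : ℕ) (t : ℝ) : ℂ :=
  (Set.Ioc (-(Real.pi / s)) (Real.pi / s)).indicator
    (fun t => pairChar w I (s * t) * Complex.exp (-(N * (s * t) : ℝ) * Complex.I)) t

lemma pairCount_eq_integral_kernel {w s : ℝ} (hw : 0 < w) (hs : 0 < s) (I N : ℕ) :
    ((pairCount I N * Real.exp (-(N * w)) / pairVal w I : ℝ) : ℂ) * (2 * Real.pi) =
      s * ∫ t, fourierKernel w s I N t := by
  rw [pairCount_eq_integral hw]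
  simp only [fourierKernel]
  rw [integral_indicator measurableSet_Ioc, ← intervalIntegral.integral_of_le
    (by have := div_pos Real.pi_pos hs; linarith)]
  have := intervalIntegral.integral_comp_mul_left (a := -(Real.pi / s)) (b := Real.pi / s)
    (fun θ => pairChar w I θ * Complex.exp (-(N * θ : ℝ) * Complex.I)) hs.ne'
  rw [this, mul_neg, mul_div_cancel₀ _ hs.ne', Complex.real_smul, ← mul_assoc]
  have hs' : (s : ℂ) ≠ 0 := by exact_mod_cast hs.ne'
  rw [Complex.ofReal_inv, mul_inv_cancel₀ hs', one_mul]

lemma measurable_fourierKernel (w s : ℝ) (I N : ℕ) : Measurable (fourierKernel w s I N) := by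
  refine Measurable.indicator ?_ measurableSet_Ioc
  simp only [pairChar]
  fun_prop

/-! ### Bounds for the characteristic function -/

/-- From `e^x - 1 = 2 e^(x/2) sinh(x/2)` and `sinh y ≥ y`. -/
lemma mul_bose_le {x : ℝ} (hx : 0 < x) : x * bose x ≤ Real.exp (-(x / 2)) := by
  have h1 : x / 2 ≤ Real.sinh (x / 2) := Real.self_le_sinh_iff.2 (by positivity)
  rw [Real.sinh_eq] at h1
  have h2 : 0 < Real.exp x - 1 := sub_pos.2 (Real.one_lt_exp_iff.2 hx)
  have h3 : Real.exp x - 1 = Real.exp (x / 2) * (Real.exp (x / 2) - Real.exp (-(x / 2))) := by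
    rw [mul_sub, ← Real.exp_add, ← Real.exp_add]
    rw [add_halves, add_neg_cancel, Real.exp_zero]
  rw [bose, ← div_eq_mul_inv, div_le_iff₀ h2, h3, ← mul_assoc, ← Real.exp_add]
  simp
  linarith

lemma sum_Ico_exp_odd {b : ℝ} (hb : 0 < b) {I n : ℕ} (h : I ≤ n) :
    ∑ i ∈ Finset.Ico I n, Real.exp (-((2 * i + 1) * b)) =
      (Real.exp (-(2 * I * b)) - Real.exp (-(2 * n * b))) / (2 * Real.sinh b) := by
  have hs : 0 < Real.sinh b := Real.sinh_pos_iff.2 hb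
  rw [eq_div_iff (by positivity)]
  induction n, h using Nat.le_induction with
  | base => simp
  | succ n hn ih =>
    rw [Finset.sum_Ico_succ_top hn, add_mul, ih, Real.sinh_eq]
    have e : Real.exp (-((2 * n + 1) * b)) * (2 * ((Real.exp b - Real.exp (-b)) / 2)) =
        Real.exp (-(2 * n * b)) - Real.exp (-(2 * (n + 1 : ℕ) * b)) := by
      rw [mul_div_cancel₀ _ two_ne_zero, mul_sub, ← Real.exp_add, ← Real.exp_add]
      push_cast
      ring_nf
    rw [e]
    ring

lemma sum_Ico_exp_odd_le {b : ℝ} (hb : 0 < b) (I n : ℕ) :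
    ∑ i ∈ Finset.Ico I n, Real.exp (-((2 * i + 1) * b)) ≤ Real.exp (-(2 * I * b)) / (2 * b) := by
  have hs : b ≤ Real.sinh b := Real.self_le_sinh_iff.2 hb.le
  rcases le_or_gt I n with h | h
  · rw [sum_Ico_exp_odd hb h]
    have := Real.exp_pos (-(2 * n * b))
    gcongr
    linarith
  · rw [Finset.Ico_eq_empty (by omega), Finset.sum_empty]
    positivity

lemma sum_range_exp_odd_le {b : ℝ} (hb : 0 < b) (n : ℕ) :
    ∑ i ∈ Finset.range n, Real.exp (-((2 * i + 1) * b)) ≤ 1 / (2 * b) := by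
  have := sum_Ico_exp_odd_le hb 0 n
  simpa using this

lemma two_mul_sin_mul_sum_cos (n : ℕ) (θ : ℝ) :
    2 * Real.sin θ * ∑ i ∈ Finset.range n, Real.cos ((2 * i + 1) * θ) = Real.sin (2 * n * θ) := by
  induction n with
  | zero => simp
  | succ n ih =>
    rw [Finset.sum_range_succ, mul_add, ih]
    have e1 : 2 * ((n + 1 : ℕ) : ℝ) * θ = (2 * n + 1) * θ + θ := by push_cast; ring
    have e2 : 2 * (n : ℝ) * θ = (2 * n + 1) * θ - θ := by ring
    rw [e1, e2, Real.sin_add, Real.sin_sub]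
    ring

/-- The sum is `sin(2nθ)/(2 sin θ)`, and Jordan's inequality gives `sin θ ≥ 2θ/π ≥ 1/n`. -/
lemma abs_sum_cos_le {n : ℕ} (hn : 1 ≤ n) {θ : ℝ} (h1 : Real.pi / (2 * n) ≤ θ)
    (h2 : θ ≤ Real.pi / 2) : |∑ i ∈ Finset.range n, Real.cos ((2 * i + 1) * θ)| ≤ n / 2 := by
  have hn' : (0 : ℝ) < n := by exact_mod_cast hn
  have hpi := Real.pi_pos
  have hθ : 0 ≤ θ := le_trans (by positivity) h1
  have hs : 1 / (n : ℝ) ≤ Real.sin θ := by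
    refine le_trans ?_ (Real.mul_le_sin hθ h2)
    calc 1 / (n : ℝ) = 2 / Real.pi * (Real.pi / (2 * n)) := by field_simp
      _ ≤ _ := by gcongr
  have hs0 : 0 < Real.sin θ := lt_of_lt_of_le (by positivity) hs
  have h := congrArg abs (two_mul_sin_mul_sum_cos n θ)
  rw [abs_mul, abs_of_pos (by positivity : 0 < 2 * Real.sin θ)] at h
  have h' : 2 * Real.sin θ * |∑ i ∈ Finset.range n, Real.cos ((2 * i + 1) * θ)| ≤ 1 := by
    rw [h]; exact Real.abs_sin_le_one _
  have : 2 * (1 / (n : ℝ)) * |∑ i ∈ Finset.range n, Real.cos ((2 * i + 1) * θ)| ≤ 1 :=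
    le_trans (by gcongr) h'
  rw [mul_one_div, div_mul_eq_mul_div, div_le_one hn'] at this
  linarith

lemma cube_le_sum_odd_sq (n : ℕ) : (n : ℝ) ^ 3 ≤ ∑ i ∈ Finset.range n, (2 * (i : ℝ) + 1) ^ 2 := by
  have h : ∑ i ∈ Finset.range n, (2 * (i : ℝ) + 1) ^ 2 = (4 * (n : ℝ) ^ 3 - n) / 3 := by
    induction n with
    | zero => simp
    | succ n ih => rw [Finset.sum_range_succ, ih]; push_cast; ring
  rw [h]
  rcases Nat.eq_zero_or_pos n with rfl | hn
  · simp
  · have : (1 : ℝ) ≤ n := by exact_mod_cast hn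
    nlinarith [mul_nonneg (by linarith : (0:ℝ) ≤ n) (by nlinarith : (0 : ℝ) ≤ (n:ℝ)^2 - 1)]

/-- For `|θ| ≤ π/(2n)` all angles stay within `π` and `1 - cos x ≥ 2x²/π²` applies termwise.
Otherwise the cosine sum is at most `n/2`. Beyond `π/2` the reflection `θ ↦ π - θ` reverses its
sign, the multiples being odd, so `θ = π` contributes no second peak. -/
lemma min_le_sum_one_sub_cos {n : ℕ} (hn : 1 ≤ n) {θ : ℝ} (hθ : |θ| ≤ Real.pi) :
    min ((n : ℝ) / 2) (2 / Real.pi ^ 2 * ((n : ℝ) ^ 3 * θ ^ 2)) ≤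
      ∑ i ∈ Finset.range n, (1 - Real.cos ((2 * i + 1) * θ)) := by
  wlog h0 : 0 ≤ θ generalizing θ
  · have := this (θ := -θ) (by rwa [abs_neg]) (by linarith)
    simpa [mul_neg] using this
  rw [abs_of_nonneg h0] at hθ
  have hn' : (0 : ℝ) < n := by exact_mod_cast hn
  have hpi := Real.pi_pos
  rcases le_or_gt θ (Real.pi / (2 * n)) with h1 | h1
  · refine (min_le_right _ _).trans ?_
    calc 2 / Real.pi ^ 2 * ((n : ℝ) ^ 3 * θ ^ 2)
        ≤ 2 / Real.pi ^ 2 * ((∑ i ∈ Finset.range n, (2 * (i : ℝ) + 1) ^ 2) * θ ^ 2) := by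
          gcongr; exact cube_le_sum_odd_sq n
      _ = ∑ i ∈ Finset.range n, 2 / Real.pi ^ 2 * ((2 * (i : ℝ) + 1) * θ) ^ 2 := by
          rw [Finset.sum_mul, Finset.mul_sum]
          exact Finset.sum_congr rfl fun i _ => by ring
      _ ≤ _ := by
          refine Finset.sum_le_sum fun i hi => ?_
          have hi' : (2 * (i : ℝ) + 1) ≤ 2 * n := by
            have := Finset.mem_range.1 hi
            have : 2 * i + 1 ≤ 2 * n := by omega
            exact_mod_cast this
          have hle : |(2 * (i : ℝ) + 1) * θ| ≤ Real.pi := by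
            rw [abs_of_nonneg (by positivity)]
            calc (2 * (i : ℝ) + 1) * θ ≤ 2 * n * (Real.pi / (2 * n)) := by gcongr
              _ = Real.pi := by field_simp
          have := Real.cos_le_one_sub_mul_cos_sq hle
          linarith
  · refine (min_le_left _ _).trans ?_
    rw [Finset.sum_sub_distrib, Finset.sum_const, Finset.card_range, nsmul_eq_mul, mul_one]
    rcases le_or_gt θ (Real.pi / 2) with h2 | h2
    · have := (abs_le.1 (abs_sum_cos_le hn h1.le h2)).2
      linarith
    · have hneg : ∑ i ∈ Finset.range n, Real.cos ((2 * i + 1) * θ) =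
          -∑ i ∈ Finset.range n, Real.cos ((2 * i + 1) * (Real.pi - θ)) := by
        rw [← Finset.sum_neg_distrib]
        refine Finset.sum_congr rfl fun i _ => ?_
        have : (2 * (i : ℝ) + 1) * (Real.pi - θ) = Real.pi - (2 * i + 1) * θ + i * (2 * Real.pi) := by
          ring
        rw [this, Real.cos_add_nat_mul_two_pi, Real.cos_pi_sub, neg_neg]
      rw [hneg]
      rcases le_or_gt (Real.pi / (2 * n)) (Real.pi - θ) with h3 | h3
      · have := (abs_le.1 (abs_sum_cos_le hn h3 (by linarith))).1
        linarith
      · rcases eq_or_lt_of_le (sub_nonneg.2 hθ) with h4 | h4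
        · rw [← h4]; simp; linarith
        · have hs : 0 < Real.sin (Real.pi - θ) := Real.sin_pos_of_pos_of_lt_pi h4 (by linarith)
          have hs2 : 0 ≤ Real.sin (2 * n * (Real.pi - θ)) := by
            refine Real.sin_nonneg_of_nonneg_of_le_pi (by positivity) ?_
            calc 2 * n * (Real.pi - θ) ≤ 2 * n * (Real.pi / (2 * n)) := by gcongr
              _ = Real.pi := by field_simp
          rw [← two_mul_sin_mul_sum_cos] at hs2
          have := nonneg_of_mul_nonneg_right hs2 (by positivity)
          linarith

lemma norm_sq_factor (m y : ℝ) :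
    ‖1 - (m : ℂ) * (Complex.exp ((y : ℝ) * Complex.I) - 1)‖ ^ 2 =
      1 + 2 * m * (1 + m) * (1 - Real.cos y) := by
  rw [Complex.sq_norm, Complex.normSq_apply, Complex.exp_mul_I, ← Complex.ofReal_cos,
    ← Complex.ofReal_sin]
  simp [-Complex.ofReal_cos, -Complex.ofReal_sin]
  linear_combination m ^ 2 * Real.sin_sq_add_cos_sq y

lemma norm_factor_le_one {m : ℝ} (hm : 0 ≤ m) (y : ℝ) :
    ‖((1 - (m : ℂ) * (Complex.exp ((y : ℝ) * Complex.I) - 1))⁻¹) ^ 2‖ ≤ 1 := by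
  rw [norm_pow, norm_inv, inv_pow, norm_sq_factor]
  refine inv_le_one_of_one_le₀ ?_
  have := Real.cos_le_one y
  have : 0 ≤ 2 * m * (1 + m) * (1 - Real.cos y) := by
    have : 0 ≤ 1 - Real.cos y := by linarith
    positivity
  linarith

/-- With `X = 1 - cos y ∈ [0, 2]`, the squared modulus is at least `1 + X` because `2m(1+m) ≥ 1`,
and `1 + X ≥ e^(X/4)` on this range. -/
lemma norm_factor_le_exp {m : ℝ} (hm : 1 / 2 ≤ m) (y : ℝ) :
    ‖((1 - (m : ℂ) * (Complex.exp ((y : ℝ) * Complex.I) - 1))⁻¹) ^ 2‖ ≤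
      Real.exp (-((1 - Real.cos y) / 4)) := by
  rw [norm_pow, norm_inv, inv_pow, norm_sq_factor, Real.exp_neg]
  refine inv_anti₀ (Real.exp_pos _) ?_
  have h1 := Real.cos_le_one y
  have h2 := Real.neg_one_le_cos y
  set X := 1 - Real.cos y with hX
  have hX0 : 0 ≤ X := by linarith
  have h3 : Real.exp (X / 4) ≤ 1 / (1 - X / 4) :=
    Real.exp_bound_div_one_sub_of_interval (by linarith) (by linarith)
  have h4 : 1 / (1 - X / 4) ≤ 1 + X := by
    rw [div_le_iff₀ (by linarith)]
    nlinarith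
  have h5 : 1 ≤ 2 * m * (1 + m) := by nlinarith
  nlinarith

lemma half_le_bose {x : ℝ} (hx : 0 < x) (h1 : x ≤ 1) : 1 / 2 ≤ bose x := by
  rw [bose, ← one_div]
  refine one_div_le_one_div_of_le (sub_pos.2 (Real.one_lt_exp_iff.2 hx)) ?_
  have := Real.exp_one_lt_d9
  have := Real.exp_le_exp.2 h1
  linarith

lemma norm_pairChar_mono {w : ℝ} (hw : 0 < w) (θ : ℝ) {I J : ℕ} (h : I ≤ J) :
    ‖pairChar w J θ‖ ≤ ‖pairChar w I θ‖ := by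
  rw [pairChar, pairChar, norm_prod, norm_prod]
  refine Finset.prod_le_prod_of_subset_of_le_one (Finset.range_subset_range.2 h)
    (fun _ _ => norm_nonneg _) fun i _ _ => norm_factor_le_one (bose_pos (by positivity)).le _

lemma norm_pairChar_le_one {w : ℝ} (hw : 0 < w) (θ : ℝ) (I : ℕ) : ‖pairChar w I θ‖ ≤ 1 := by
  simpa [pairChar] using norm_pairChar_mono hw θ (Nat.zero_le I)

/-- The number `K` of odd parts of size at most `1 / w` satisfies these bounds. -/
lemma exists_numParts {w : ℝ} (hw : 0 < w) (hw' : w ≤ 1 / 4) :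
    ∃ K : ℕ, 1 ≤ K ∧ 1 / (4 * w) ≤ K ∧ 2 * K * w ≤ 1 := by
  refine ⟨⌊1 / (2 * w)⌋₊, ?_, ?_, ?_⟩
  · rw [Nat.one_le_floor_iff, le_div_iff₀ (by positivity)]
    linarith
  · have h1 := Nat.lt_floor_add_one (1 / (2 * w))
    have h2 : 1 / (2 * w) = 1 / (4 * w) + 1 / (4 * w) := by field_simp; norm_num
    have h3 : 1 ≤ 1 / (4 * w) := by rw [le_div_iff₀ (by positivity)]; linarith
    linarith
  · have h1 := Nat.floor_le (by positivity : 0 ≤ 1 / (2 * w))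
    calc 2 * (⌊1 / (2 * w)⌋₊ : ℝ) * w ≤ 2 * (1 / (2 * w)) * w := by gcongr
      _ = 1 := by field_simp

lemma half_le_bose_of_lt {w : ℝ} (hw : 0 < w) {K i : ℕ} (hK : 2 * K * w ≤ 1) (hi : i < K) :
    1 / 2 ≤ bose ((2 * i + 1) * w) := by
  refine half_le_bose (by positivity) (le_trans ?_ hK)
  have : 2 * i + 1 ≤ 2 * K := by omega
  have : (2 * i + 1 : ℝ) ≤ 2 * K := by exact_mod_cast this
  gcongr

/-- Domination of the characteristic function, on the scale `w = δ ^ 2`, `θ = δ ^ 3 * t`. -/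
lemma norm_pairChar_le {δ : ℝ} (hδ : 0 < δ) (hδ' : δ ≤ 1 / 2) {I : ℕ} (hI : 1 ≤ 2 * I * δ ^ 2)
    {t : ℝ} (ht : |δ ^ 3 * t| ≤ Real.pi) :
    ‖pairChar (δ ^ 2) I (δ ^ 3 * t)‖ ≤ 2 ^ 30 / (1 + t ^ 2) := by
  have hw : 0 < δ ^ 2 := by positivity
  -- Only parts `k` with `kw ≤ 1` are used: there the occupation number is at least `1/2`, and every
  -- other factor has norm at most `1`.
  obtain ⟨K, hK1, hK2, hK3⟩ := exists_numParts hw (by nlinarith)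
  have hKI : K ≤ I := by
    have : 2 * (K : ℝ) * δ ^ 2 ≤ 2 * I * δ ^ 2 := hK3.trans hI
    have : (K : ℝ) ≤ I := by
      have := le_of_mul_le_mul_right this hw
      linarith
    exact_mod_cast this
  have hpi := Real.pi_pos
  have hpi4 := Real.pi_le_four
  have hle1 := norm_pairChar_le_one hw (δ ^ 3 * t) I
  have hS := min_le_sum_one_sub_cos hK1 ht
  set S := ∑ i ∈ Finset.range K, (1 - Real.cos ((2 * i + 1) * (δ ^ 3 * t)))
  have hexp : ‖pairChar (δ ^ 2) I (δ ^ 3 * t)‖ ≤ Real.exp (-(S / 4)) := by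
    refine (norm_pairChar_mono hw _ hKI).trans ?_
    rw [pairChar, norm_prod]
    simp only [S]
    rw [Finset.sum_div, ← Finset.sum_neg_distrib, Real.exp_sum]
    exact Finset.prod_le_prod (fun _ _ => norm_nonneg _) fun i hi =>
      norm_factor_le_exp (half_le_bose_of_lt hw hK3 (Finset.mem_range.1 hi)) _
  have hkey : ‖pairChar (δ ^ 2) I (δ ^ 3 * t)‖ * t ^ 2 ≤ 2 ^ 29 := by
    -- Away from `0` the exponent is at least `1/(32δ²)`, and its cubic Taylor term beats `t² ≤
    -- 16/δ^6`, which follows from `|θ| ≤ π`. Near `0` the exponent is at least `t²/2^11`, of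
    -- Gaussian type.
    rcases min_le_iff.1 hS with h | h
    · have hx : 1 / (32 * δ ^ 2) ≤ S / 4 := by
        have : 1 / (32 * δ ^ 2) = 1 / (4 * δ ^ 2) / 2 / 4 := by field_simp; norm_num
        rw [this]
        linarith
      have h6 := Real.pow_div_factorial_le_exp _ (by positivity : 0 ≤ 1 / (32 * δ ^ 2)) 3
      have ht2 : t ^ 2 * δ ^ 6 ≤ 16 := by
        calc t ^ 2 * δ ^ 6 = |δ ^ 3 * t| ^ 2 := by rw [sq_abs]; ring
          _ ≤ Real.pi ^ 2 := by gcongr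
          _ ≤ 16 := by nlinarith
      have h7 : t ^ 2 ≤ 2 ^ 29 * Real.exp (S / 4) := by
        calc t ^ 2 = t ^ 2 * δ ^ 6 * (1 / δ ^ 6) := by field_simp
          _ ≤ 16 * (1 / δ ^ 6) := by gcongr
          _ ≤ 2 ^ 29 * ((1 / (32 * δ ^ 2)) ^ 3 / (Nat.factorial 3)) := by
            have : 2 ^ 29 * ((1 / (32 * δ ^ 2)) ^ 3 / (Nat.factorial 3 : ℝ)) =
              (2 ^ 29 / (32 ^ 3 * 6)) * (1 / δ ^ 6) := by
              rw [show Nat.factorial 3 = 6 from rfl]; field_simp; norm_num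
            rw [this]
            gcongr
            norm_num
          _ ≤ _ := by gcongr; exact h6.trans (Real.exp_le_exp.2 hx)
      calc _ ≤ Real.exp (-(S / 4)) * (2 ^ 29 * Real.exp (S / 4)) := by gcongr
        _ = 2 ^ 29 := by rw [Real.exp_neg]; field_simp
    · have hx : t ^ 2 / 2 ^ 11 ≤ S / 4 := by
        have h8 : t ^ 2 / 2 ^ 6 ≤ (K : ℝ) ^ 3 * (δ ^ 3 * t) ^ 2 := by
          calc t ^ 2 / 2 ^ 6 = (1 / (4 * δ ^ 2)) ^ 3 * (δ ^ 3 * t) ^ 2 := by field_simp; norm_num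
            _ ≤ _ := by gcongr
        have h9 : 1 / 2 ^ 3 ≤ 2 / Real.pi ^ 2 := by
          rw [div_le_div_iff₀ (by positivity) (by positivity)]
          nlinarith
        have : t ^ 2 / 2 ^ 9 ≤ S := by
          refine le_trans ?_ h
          calc t ^ 2 / 2 ^ 9 = 1 / 2 ^ 3 * (t ^ 2 / 2 ^ 6) := by ring
            _ ≤ _ := by gcongr
        linarith
      have h7 : t ^ 2 ≤ 2 ^ 11 * Real.exp (S / 4) := by
        have := Real.add_one_le_exp (t ^ 2 / 2 ^ 11)
        have := Real.exp_le_exp.2 hx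
        linarith
      calc _ ≤ Real.exp (-(S / 4)) * (2 ^ 11 * Real.exp (S / 4)) := by gcongr
        _ = 2 ^ 11 := by rw [Real.exp_neg]; field_simp
        _ ≤ _ := by norm_num
  rw [le_div_iff₀ (by positivity), mul_add, mul_one]
  linarith

/-! ### The mean size -/

lemma measurable_bose : Measurable bose := by
  unfold bose
  fun_prop

lemma integrableOn_mul_bose : IntegrableOn (fun x => x * bose x) (Set.Ioi 0) := by
  have h : IntegrableOn (fun x : ℝ => Real.exp (-(1 / 2) * x)) (Set.Ioi 0) :=
    integrableOn_exp_mul_Ioi (by norm_num) 0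
  refine Integrable.mono' h (measurable_id.mul measurable_bose).aestronglyMeasurable ?_
  filter_upwards [ae_restrict_mem measurableSet_Ioi] with x hx
  rw [Real.norm_of_nonneg (mul_nonneg (le_of_lt hx) (bose_pos hx).le)]
  convert mul_bose_le hx using 2
  ring

/-- Expand `1/(e^x - 1) = ∑ e^(-(i+1)x)`; the Mellin transform at `2` is `Γ(2) ζ(2)`. -/
lemma integral_mul_bose : ∫ x in Set.Ioi 0, x * bose x = Real.pi ^ 2 / 6 := by
  have hz : HasSum (fun n : ℕ => 1 / ((n : ℝ) + 1) ^ 2) (Real.pi ^ 2 / 6) := by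
    have := (hasSum_nat_add_iff' 1).2 hasSum_zeta_two
    simpa using this
  have hF : ∀ t ∈ Set.Ioi (0 : ℝ), HasSum (fun i : ℕ => (1 : ℂ) * Real.exp (-((i : ℝ) + 1) * t))
      ((bose t : ℝ) : ℂ) := by
    intro t ht
    have ht' : 0 < t := ht
    have hlt : Real.exp (-t) < 1 := Real.exp_lt_one_iff.2 (by linarith)
    have h1 := (hasSum_geometric_of_lt_one (Real.exp_pos (-t)).le hlt).mul_left (Real.exp (-t))
    have h2 : Real.exp (-t) * (1 - Real.exp (-t))⁻¹ = bose t := by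
      have : 0 < Real.exp t - 1 := sub_pos.2 (Real.one_lt_exp_iff.2 ht)
      have := Real.exp_pos t
      rw [bose, Real.exp_neg]
      field_simp
    rw [h2] at h1
    have h3 := (Complex.hasSum_ofReal (f := fun i : ℕ => Real.exp (-t) * Real.exp (-t) ^ i)).2 h1
    refine h3.congr_fun fun i => ?_
    rw [one_mul, ← Real.exp_nat_mul, ← Real.exp_add]
    congr 2
    ring
  have hm := hasSum_mellin (a := fun _ : ℕ => (1 : ℂ)) (p := fun i : ℕ => (i : ℝ) + 1)
    (F := fun t => ((bose t : ℝ) : ℂ)) (s := 2) (fun i => Or.inr (by positivity)) (by norm_num) hF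
    (by simpa using hz.summable)
  have hm2 : HasSum (fun n : ℕ => ((1 / ((n : ℝ) + 1) ^ 2 : ℝ) : ℂ))
      (mellin (fun t => ((bose t : ℝ) : ℂ)) 2) := by
    refine hm.congr_fun fun n => ?_
    have : Complex.Gamma 2 = 1 := by norm_num
    rw [this]
    push_cast
    simp
  have h4 := hm2.unique (Complex.hasSum_ofReal.2 hz)
  have h5 : mellin (fun t => ((bose t : ℝ) : ℂ)) 2 = ((∫ x in Set.Ioi 0, x * bose x : ℝ) : ℂ) := by
    rw [mellin, ← integral_complex_ofReal]
    refine setIntegral_congr_fun measurableSet_Ioi fun t ht => ?_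
    norm_num
  rw [h5] at h4
  exact_mod_cast h4

/-- The function is the reciprocal of the slope of the secant of `exp` from `0` to `x`, which
increases by convexity. -/
lemma antitoneOn_mul_bose : AntitoneOn (fun x => x * bose x) (Set.Ioi 0) := by
  intro x hx y hy hxy
  have hx' : (0 : ℝ) < x := hx
  have hy' : (0 : ℝ) < y := hy
  have h1 : 0 < Real.exp x - 1 := sub_pos.2 (Real.one_lt_exp_iff.2 hx)
  have h2 : 0 < Real.exp y - 1 := sub_pos.2 (Real.one_lt_exp_iff.2 hy)
  have h := convexOn_exp.secant_mono (a := 0) (x := x) (y := y) (Set.mem_univ _) (Set.mem_univ _)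
    (Set.mem_univ _) hx'.ne' hy'.ne' hxy
  rw [Real.exp_zero, sub_zero, sub_zero, div_le_div_iff₀ hx' hy'] at h
  simp only [bose, ← div_eq_mul_inv]
  rw [div_le_div_iff₀ h2 h1]
  linarith

lemma mul_bose_le_one {x : ℝ} (hx : 0 < x) : x * bose x ≤ 1 :=
  (mul_bose_le hx).trans (Real.exp_le_one_iff.2 (by linarith))

lemma intervalIntegral_mul_bose_le {a b : ℝ} (ha : 0 < a) (hab : a ≤ b) :
    ∫ x in a..b, x * bose x ≤ Real.pi ^ 2 / 6 := by
  rw [intervalIntegral.integral_of_le hab, ← integral_mul_bose]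
  refine setIntegral_mono_set integrableOn_mul_bose ?_
    (LE.le.eventuallyLE fun x hx => ha.trans hx.1)
  filter_upwards [ae_restrict_mem measurableSet_Ioi] with x hx
  exact mul_nonneg (le_of_lt hx) (bose_pos hx).le

lemma le_intervalIntegral_mul_bose {a b : ℝ} (ha : 0 < a) (hab : a ≤ b) :
    Real.pi ^ 2 / 6 - a - 2 * Real.exp (-(b / 2)) ≤ ∫ x in a..b, x * bose x := by
  have hI := integrableOn_mul_bose
  have e1 : Set.Ioi (0 : ℝ) = Set.Ioc 0 a ∪ (Set.Ioc a b ∪ Set.Ioi b) := by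
    rw [Set.Ioc_union_Ioi_eq_Ioi hab, Set.Ioc_union_Ioi_eq_Ioi ha.le]
  have s1 : Set.Ioc 0 a ⊆ Set.Ioi 0 := fun x hx => hx.1
  have s2 : Set.Ioc a b ⊆ Set.Ioi 0 := fun x hx => ha.trans hx.1
  have s3 : Set.Ioi b ⊆ Set.Ioi 0 := fun x hx => (ha.trans_le hab).trans hx
  have h := integral_mul_bose
  rw [e1, setIntegral_union _ (by measurability) (hI.mono_set s1)
    ((hI.mono_set s2).union (hI.mono_set s3)),
    setIntegral_union _ measurableSet_Ioi (hI.mono_set s2) (hI.mono_set s3),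
    ← intervalIntegral.integral_of_le hab] at h
  · have h1 : ∫ x in Set.Ioc 0 a, x * bose x ≤ a := by
      calc ∫ x in Set.Ioc 0 a, x * bose x ≤ ∫ _ in Set.Ioc 0 a, (1 : ℝ) :=
            setIntegral_mono_on (hI.mono_set s1) (by simp) measurableSet_Ioc
              fun x hx => mul_bose_le_one hx.1
        _ = a := by simp [ha.le]
    have h3 : ∫ x in Set.Ioi b, x * bose x ≤ 2 * Real.exp (-(b / 2)) := by
      have h4 : IntegrableOn (fun x : ℝ => Real.exp (-(1 / 2) * x)) (Set.Ioi b) :=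
        integrableOn_exp_mul_Ioi (by norm_num) b
      calc ∫ x in Set.Ioi b, x * bose x ≤ ∫ x in Set.Ioi b, Real.exp (-(1 / 2) * x) := by
            refine setIntegral_mono_on (hI.mono_set s3) h4 measurableSet_Ioi fun x hx => ?_
            rw [show -(1 / 2) * x = -(x / 2) by ring]
            exact mul_bose_le (s3 hx)
        _ = 2 * Real.exp (-(b / 2)) := by
            rw [integral_exp_mul_Ioi (by norm_num), show -(1 / 2) * b = -(b / 2) by ring]
            ring
    linarith
  · exact Set.disjoint_left.2 fun x hx hx' => not_lt.2 hx.2 hx'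
  · refine Set.disjoint_left.2 fun x hx hx' => ?_
    rcases hx' with hx' | hx'
    · exact not_lt.2 hx.2 hx'.1
    · exact not_lt.2 (hx.2.trans hab) hx'

/-- With `n * w ^ 2 = π ^ 2 / 6`, the mean size is `n + O(1 / w)`. -/
lemma abs_mean_sub_le {w : ℝ} (hw : 0 < w) {n : ℕ} (hn : n * w ^ 2 = Real.pi ^ 2 / 6) :
    |∑ i ∈ Finset.range n, 2 * (2 * (i : ℝ) + 1) * bose ((2 * i + 1) * w) - n| ≤ 4 / w := by
  set g : ℝ → ℝ := fun x => ((2 * x + 1) * w) * bose ((2 * x + 1) * w) with hg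
  have hpos : ∀ x : ℝ, 0 ≤ x → 0 < (2 * x + 1) * w := fun x hx => by positivity
  -- The mean is `2/w` times a sum of samples, with step `2w`, of the decreasing function `x * bose
  -- x ≤ 1`. Comparison with the integral costs at most one sample, hence `O(1/w)` in the mean.
  have hanti : AntitoneOn g (Set.Icc 0 (0 + n)) := by
    intro x hx y hy hxy
    exact antitoneOn_mul_bose (hpos x hx.1) (hpos y hy.1) (by gcongr)
  have hint : ∫ x in (0 : ℝ)..(0 + n), g x = 1 / (2 * w) *
      ∫ x in w..((2 * n + 1) * w), x * bose x := by
    have := intervalIntegral.integral_comp_mul_add (a := 0) (b := n) (fun x => x * bose x)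
      (by positivity : 2 * w ≠ 0) w
    rw [zero_add]
    calc ∫ x in (0 : ℝ)..n, g x = ∫ x in (0 : ℝ)..n, (2 * w * x + w) * bose (2 * w * x + w) := by
          refine intervalIntegral.integral_congr fun x _ => ?_
          simp only [hg]
          ring_nf
      _ = _ := by
          rw [this, smul_eq_mul, one_div]
          congr 2 <;> ring
  have hab : w ≤ (2 * n + 1) * w := by
    have : (0 : ℝ) ≤ n := by positivity
    nlinarith
  have hup := AntitoneOn.sum_le_integral hanti
  have hlo := AntitoneOn.integral_le_sum hanti
  rw [hint] at hup hlo
  have hM : ∑ i ∈ Finset.range n, 2 * (2 * (i : ℝ) + 1) * bose ((2 * i + 1) * w) =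
      2 / w * ∑ i ∈ Finset.range n, g (0 + i) := by
    rw [Finset.mul_sum]
    refine Finset.sum_congr rfl fun i _ => ?_
    simp only [hg, zero_add]
    field_simp
  have hshift : ∑ i ∈ Finset.range n, g (0 + i) ≤
      1 + ∑ i ∈ Finset.range n, g (0 + (i + 1 : ℕ)) := by
    have h1 := Finset.sum_range_succ (fun i : ℕ => g (0 + i)) n
    have h2 := Finset.sum_range_succ' (fun i : ℕ => g (0 + i)) n
    have h3 : g (0 + (0 : ℕ)) ≤ 1 := by
      have := mul_bose_le_one hw
      simpa [hg] using this
    have h4 : 0 ≤ g (0 + n) := by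
      have := hpos (0 + n) (by positivity)
      exact mul_nonneg this.le (bose_pos this).le
    linarith
  have hn' : (n : ℝ) = Real.pi ^ 2 / 6 / w ^ 2 := by
    rw [← hn]; field_simp
  have hpi := Real.pi_gt_three
  have hn0 : (0 : ℝ) < n := by rw [hn']; positivity
  -- As `n w² = π²/6 ≥ 1`, cutting the integral off at `(2n+1)w` loses only `O(w)`.
  have hexp : Real.exp (-((2 * n + 1) * w / 2)) ≤ w := by
    have h1 : 1 ≤ n * w * w := by
      have : n * w * w = n * w ^ 2 := by ring
      rw [this, hn]; nlinarith
    have h2 : (n : ℝ) * w ≤ Real.exp ((2 * n + 1) * w / 2) := by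
      have := Real.add_one_le_exp ((2 * n + 1) * w / 2)
      nlinarith
    rw [Real.exp_neg, inv_le_comm₀ (Real.exp_pos _) hw]
    refine le_trans ?_ h2
    rw [inv_le_iff_one_le_mul₀ hw]
    exact h1
  have hIup := intervalIntegral_mul_bose_le hw hab
  have hIlo := le_intervalIntegral_mul_bose hw hab
  set J := ∫ x in w..((2 * n + 1) * w), x * bose x
  set S := ∑ i ∈ Finset.range n, g (0 + i)
  rw [hM, abs_le]
  constructor
  · have h1 : 2 / w * (1 / (2 * w) * (Real.pi ^ 2 / 6 - w - 2 * w)) ≤ 2 / w * S := by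
      have : Real.pi ^ 2 / 6 - w - 2 * w ≤ J := by linarith
      have : 1 / (2 * w) * (Real.pi ^ 2 / 6 - w - 2 * w) ≤ S := le_trans (by gcongr) hlo
      gcongr
    have h2 : 2 / w * (1 / (2 * w) * (Real.pi ^ 2 / 6 - w - 2 * w)) = n - 3 / w := by
      rw [hn']; field_simp; ring
    have h3 : 3 / w ≤ 4 / w := by gcongr; norm_num
    linarith
  · have h1 : 2 / w * S ≤ 2 / w * (1 + 1 / (2 * w) * (Real.pi ^ 2 / 6)) := by
      have : 1 / (2 * w) * J ≤ 1 / (2 * w) * (Real.pi ^ 2 / 6) := by gcongr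
      have : S ≤ 1 + 1 / (2 * w) * (Real.pi ^ 2 / 6) := by linarith
      gcongr
    have h2 : 2 / w * (1 + 1 / (2 * w) * (Real.pi ^ 2 / 6)) = n + 2 / w := by
      rw [hn']; field_simp; ring
    have h3 : 2 / w ≤ 4 / w := by gcongr; norm_num
    linarith

/-! ### The Gaussian limit of the characteristic function -/

lemma norm_exp_mul_I_sub_one_le (y : ℝ) : ‖Complex.exp (y * Complex.I) - 1‖ ≤ |y| := by
  have := @Real.norm_exp_I_mul_ofReal_sub_one_le y
  rwa [mul_comm, Real.norm_eq_abs] at this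

/-- Taylor's bound for `|y| ≤ 1`, the triangle inequality beyond. All `y` must be allowed, because
`norm_log_factor_sub_le` assumes only that `m * |y|` is small. -/
lemma norm_exp_mul_I_sub_le (y : ℝ) :
    ‖Complex.exp (y * Complex.I) - 1 - y * Complex.I‖ ≤ 2 * |y| ^ 2 := by
  have hn : ‖(y * Complex.I : ℂ)‖ = |y| := by simp
  rcases le_or_gt |y| 1 with h | h
  · have := Complex.exp_bound (x := y * Complex.I) (by rwa [hn]) (n := 2) (by norm_num)
    rw [hn] at this
    norm_num [Finset.sum_range_succ] at this
    rw [sub_sub]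
    refine this.trans ?_
    nlinarith [sq_nonneg |y|, sq_abs y]
  · calc _ ≤ ‖Complex.exp (y * Complex.I) - 1‖ + ‖(y * Complex.I : ℂ)‖ := norm_sub_le _ _
      _ ≤ |y| + |y| := by rw [hn]; gcongr; exact norm_exp_mul_I_sub_one_le y
      _ ≤ _ := by nlinarith

lemma norm_exp_mul_I_sub_sub_le (y : ℝ) :
    ‖Complex.exp (y * Complex.I) - 1 - y * Complex.I + y ^ 2 / 2‖ ≤ 3 * |y| ^ 3 := by
  have hn : ‖(y * Complex.I : ℂ)‖ = |y| := by simp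
  rcases le_or_gt |y| 1 with h | h
  · have := Complex.exp_bound (x := y * Complex.I) (by rwa [hn]) (n := 3) (by norm_num)
    rw [hn] at this
    norm_num [Finset.sum_range_succ, mul_pow, Nat.factorial] at this
    have e : Complex.exp (y * Complex.I) - 1 - y * Complex.I + y ^ 2 / 2 =
        Complex.exp (y * Complex.I) - (1 + y * Complex.I + -(y : ℂ) ^ 2 / 2) := by ring
    rw [e]
    refine this.trans ?_
    have : 0 ≤ |y| ^ 3 := by positivity
    linarith
  · have h2 : ‖((y : ℂ) ^ 2 / 2)‖ = |y| ^ 2 / 2 := by simp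
    calc _ ≤ ‖Complex.exp (y * Complex.I) - 1 - y * Complex.I‖ + ‖((y : ℂ) ^ 2 / 2)‖ :=
          norm_add_le _ _
      _ ≤ 2 * |y| ^ 2 + |y| ^ 2 / 2 := by rw [h2]; gcongr; exact norm_exp_mul_I_sub_le y
      _ ≤ 3 * |y| ^ 2 := by nlinarith [sq_nonneg |y|]
      _ ≤ _ := by
        have : |y| ^ 2 ≤ |y| ^ 3 := pow_le_pow_right₀ h.le (by norm_num)
        linarith

/-- Second-order cumulant expansion: a geometric variable of mean `m` has variance `m + m²`. It
comes from `-log(1 - u) = u + u²/2 + O(u³)` at `u = m (e^(iy) - 1)`. -/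
lemma norm_log_factor_sub_le {m y : ℝ} (hm : 0 ≤ m) (h : m * |y| ≤ 1 / 2) :
    ‖Complex.log ((1 - (m : ℂ) * (Complex.exp (y * Complex.I) - 1))⁻¹) -
      (m * y * Complex.I - (m + m ^ 2) * y ^ 2 / 2)‖ ≤ 3 * ((m + m ^ 2 + m ^ 3) * |y| ^ 3) := by
  set E := Complex.exp (y * Complex.I) - 1 with hE
  have hE1 : ‖E‖ ≤ |y| := norm_exp_mul_I_sub_one_le y
  have hE2 : ‖E - y * Complex.I‖ ≤ 2 * |y| ^ 2 := norm_exp_mul_I_sub_le y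
  have hE3 : ‖E - y * Complex.I + y ^ 2 / 2‖ ≤ 3 * |y| ^ 3 := norm_exp_mul_I_sub_sub_le y
  have hmn : ‖(m : ℂ)‖ = m := by simp [abs_of_nonneg hm]
  have hu : ‖(m : ℂ) * E‖ ≤ m * |y| := by rw [norm_mul, hmn]; gcongr
  have hu2 : ‖(m : ℂ) * E‖ ≤ 1 / 2 := hu.trans h
  have h1 := Complex.norm_log_one_sub_inv_add_logTaylor_neg_le 2 (z := m * E)
    (lt_of_le_of_lt hu2 (by norm_num))
  have hT : Complex.logTaylor (2 + 1) (-(m * E)) = -(m * E) - (m * E) ^ 2 / 2 := by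
    simp only [Complex.logTaylor_succ, Complex.logTaylor_zero]
    norm_num
    ring
  rw [hT] at h1
  have h2 : ‖(m : ℂ) * E‖ ^ (2 + 1) * (1 - ‖(m : ℂ) * E‖)⁻¹ / ((2 : ℕ) + 1) ≤ (m * |y|) ^ 3 := by
    have : (1 - ‖(m : ℂ) * E‖)⁻¹ ≤ 2 := by
      rw [inv_le_comm₀ (by linarith) two_pos]; linarith
    have h3 : ‖(m : ℂ) * E‖ ^ 3 ≤ (m * |y|) ^ 3 := by gcongr
    calc _ ≤ ‖(m : ℂ) * E‖ ^ 3 * 2 / 3 := by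
          rw [show ((2 : ℕ) : ℝ) + 1 = 3 by norm_num]
          exact div_le_div_of_nonneg_right (mul_le_mul_of_nonneg_left this (by positivity))
            (by norm_num)
      _ ≤ ‖(m : ℂ) * E‖ ^ 3 := by
          have : 0 ≤ ‖(m : ℂ) * E‖ ^ 3 := by positivity
          linarith
      _ ≤ _ := h3
  -- Three cubic errors: the logarithm's remainder, the Taylor remainder of `E`, and `E² - (iy)²`
  -- factored as a difference of squares.
  have e : Complex.log ((1 - (m : ℂ) * E)⁻¹) - (m * y * Complex.I - (m + m ^ 2) * y ^ 2 / 2) =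
      (Complex.log ((1 - (m : ℂ) * E)⁻¹) + (-(m * E) - (m * E) ^ 2 / 2)) +
      (m : ℂ) * (E - y * Complex.I + y ^ 2 / 2) +
      (m : ℂ) ^ 2 / 2 * ((E - y * Complex.I) * (E + y * Complex.I)) := by
    linear_combination ((m : ℂ) ^ 2 / 2 * y ^ 2) * Complex.I_sq
  rw [e]
  have h4 : ‖(m : ℂ) * (E - y * Complex.I + y ^ 2 / 2)‖ ≤ m * (3 * |y| ^ 3) := by
    rw [norm_mul, hmn]; gcongr
  have h5 : ‖(m : ℂ) ^ 2 / 2 * ((E - y * Complex.I) * (E + y * Complex.I))‖ ≤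
      m ^ 2 / 2 * (2 * |y| ^ 2 * (2 * |y|)) := by
    have h6 : ‖(m : ℂ) ^ 2 / 2‖ = m ^ 2 / 2 := by
      rw [norm_div, norm_pow, hmn]; norm_num
    have h7 : ‖E + y * Complex.I‖ ≤ 2 * |y| := by
      refine (norm_add_le _ _).trans ?_
      have : ‖(y * Complex.I : ℂ)‖ = |y| := by simp
      linarith
    rw [norm_mul, norm_mul, h6]
    gcongr
  refine (norm_add₃_le).trans ?_
  have h8 : 0 ≤ m ^ 2 * |y| ^ 3 := by positivity
  have h9 : 0 ≤ m ^ 3 * |y| ^ 3 := by positivity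
  nlinarith [h1.trans h2]

/-- The normalised variance of the size. -/
noncomputable def normVar (δ : ℝ) (n : ℕ) : ℝ :=
  δ ^ 6 * ∑ i ∈ Finset.range n, 2 * (2 * (i : ℝ) + 1) ^ 2 *
    (bose ((2 * i + 1) * δ ^ 2) + bose ((2 * i + 1) * δ ^ 2) ^ 2)

lemma mul_bose_mul_le {k w : ℝ} (hk : 0 < k) (hw : 0 < w) :
    k * bose (k * w) ≤ Real.exp (-(k * w / 2)) / w := by
  rw [le_div_iff₀ hw]
  have := mul_bose_le (mul_pos hk hw)
  linarith

/-- Put `x = kw` and `q = e^(-x/4)`. Then `x * bose x ≤ q²`, and spare powers of `q` absorb `x` and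
`x²` through `xq ≤ 4` and `x²q ≤ 32`; the constant is `32 + 4 + 1`. -/
lemma cube_bose_le {k w : ℝ} (hk : 0 < k) (hw : 0 < w) :
    (bose (k * w) + bose (k * w) ^ 2 + bose (k * w) ^ 3) * k ^ 3 ≤
      37 / w ^ 3 * Real.exp (-(k * (w / 4))) := by
  set x := k * w with hx
  have hx0 : 0 < x := mul_pos hk hw
  have hb := bose_pos hx0
  set q := Real.exp (-(x / 4)) with hq
  have hq0 : 0 < q := Real.exp_pos _
  have hq1 : q ≤ 1 := Real.exp_le_one_iff.2 (by linarith)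
  have hqq : q * Real.exp (x / 4) = 1 := by rw [hq, ← Real.exp_add]; simp
  have h2 : x * bose x ≤ q ^ 2 := by
    refine (mul_bose_le hx0).trans (le_of_eq ?_)
    rw [hq, ← Real.exp_nat_mul]; congr 1; push_cast; ring
  have e1 : x * q ≤ 4 := by
    have := Real.add_one_le_exp (x / 4)
    nlinarith
  have e2 : x ^ 2 * q ≤ 32 := by
    have := Real.quadratic_le_exp_of_nonneg (by positivity : 0 ≤ x / 4)
    nlinarith
  have hk' : k = x / w := by rw [hx]; field_simp
  have hq' : Real.exp (-(k * (w / 4))) = q := by rw [hq, hx]; ring_nf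
  rw [hq', hk', div_pow, mul_div_assoc', div_mul_eq_mul_div]
  refine div_le_div_of_nonneg_right ?_ (by positivity)
  have h0 : 0 ≤ x * bose x := by positivity
  calc (bose x + bose x ^ 2 + bose x ^ 3) * x ^ 3
      = (x * bose x) * x ^ 2 + (x * bose x) ^ 2 * x + (x * bose x) ^ 3 := by ring
    _ ≤ q ^ 2 * x ^ 2 + (q ^ 2) ^ 2 * x + (q ^ 2) ^ 3 := by gcongr
    _ = (x ^ 2 * q) * q + q ^ 2 * ((x * q) * q) + q ^ 5 * q := by ring
    _ ≤ 32 * q + 1 * (4 * q) + 1 * q := by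
        gcongr <;> exact pow_le_one₀ hq0.le hq1
    _ = 37 * q := by ring

lemma sq_bose_le {k w : ℝ} (hk : 0 < k) (hw : 0 < w) :
    k ^ 2 * (bose (k * w) + bose (k * w) ^ 2) ≤ 5 / w ^ 2 * Real.exp (-(k * (w / 4))) := by
  set x := k * w with hx
  have hx0 : 0 < x := mul_pos hk hw
  have hb := bose_pos hx0
  set q := Real.exp (-(x / 4)) with hq
  have hq0 : 0 < q := Real.exp_pos _
  have hq1 : q ≤ 1 := Real.exp_le_one_iff.2 (by linarith)
  have hqq : q * Real.exp (x / 4) = 1 := by rw [hq, ← Real.exp_add]; simp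
  have h2 : x * bose x ≤ q ^ 2 := by
    refine (mul_bose_le hx0).trans (le_of_eq ?_)
    rw [hq, ← Real.exp_nat_mul]; congr 1; push_cast; ring
  have e1 : x * q ≤ 4 := by
    have := Real.add_one_le_exp (x / 4)
    nlinarith
  have hk' : k = x / w := by rw [hx]; field_simp
  have hq' : Real.exp (-(k * (w / 4))) = q := by rw [hq, hx]; ring_nf
  rw [hq', hk', div_pow, div_mul_eq_mul_div, div_mul_eq_mul_div]
  refine div_le_div_of_nonneg_right ?_ (by positivity)
  have h0 : 0 ≤ x * bose x := by positivity
  calc x ^ 2 * (bose x + bose x ^ 2)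
      = (x * bose x) * x + (x * bose x) ^ 2 := by ring
    _ ≤ q ^ 2 * x + (q ^ 2) ^ 2 := by gcongr
    _ = (x * q) * q + q ^ 3 * q := by ring
    _ ≤ 4 * q + 1 * q := by gcongr; exact pow_le_one₀ hq0.le hq1
    _ = 5 * q := by ring

lemma normVar_le {δ : ℝ} (hδ : 0 < δ) (n : ℕ) : normVar δ n ≤ 20 := by
  have hw : 0 < δ ^ 2 := by positivity
  calc normVar δ n ≤ δ ^ 6 * ∑ i ∈ Finset.range n,
        2 * (5 / (δ ^ 2) ^ 2 * Real.exp (-((2 * i + 1) * (δ ^ 2 / 4)))) := by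
        refine mul_le_mul_of_nonneg_left (Finset.sum_le_sum fun i _ => ?_) (by positivity)
        have := sq_bose_le (by positivity : (0 : ℝ) < 2 * i + 1) hw
        linarith
    _ = δ ^ 6 * (2 * (5 / (δ ^ 2) ^ 2) *
        ∑ i ∈ Finset.range n, Real.exp (-((2 * i + 1) * (δ ^ 2 / 4)))) := by
        rw [Finset.mul_sum (f := fun i : ℕ => Real.exp (-((2 * i + 1) * (δ ^ 2 / 4))))]
        congr 1
        exact Finset.sum_congr rfl fun i _ => by ring
    _ ≤ δ ^ 6 * (2 * (5 / (δ ^ 2) ^ 2) * (1 / (2 * (δ ^ 2 / 4)))) := by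
        gcongr
        exact sum_range_exp_odd_le (by positivity) n
    _ = 20 := by field_simp; norm_num

/-- The parts `k ≤ 1/w` alone suffice: for them `k w * bose (k w) ≥ 1/2`. With `normVar_le` this
confines the variance to a fixed interval; its limit is never needed. -/
lemma le_normVar {δ : ℝ} (hδ : 0 < δ) (hδ' : δ ≤ 1 / 2) {n : ℕ} (hn : 1 ≤ 2 * n * δ ^ 2) :
    1 / 8 ≤ normVar δ n := by
  have hw : 0 < δ ^ 2 := by positivity
  obtain ⟨K, hK1, hK2, hK3⟩ := exists_numParts hw (by nlinarith)
  have hKn : K ≤ n := by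
    have : 2 * (K : ℝ) * δ ^ 2 ≤ 2 * n * δ ^ 2 := hK3.trans hn
    have : (K : ℝ) ≤ n := by
      have := le_of_mul_le_mul_right this hw
      linarith
    exact_mod_cast this
  have hterm : ∀ i ∈ Finset.range K, 1 / (2 * (δ ^ 2) ^ 2) ≤ 2 * (2 * (i : ℝ) + 1) ^ 2 *
      (bose ((2 * i + 1) * δ ^ 2) + bose ((2 * i + 1) * δ ^ 2) ^ 2) := by
    intro i hi
    have hk : (0 : ℝ) < 2 * i + 1 := by positivity
    have hx : 0 < (2 * (i : ℝ) + 1) * δ ^ 2 := by positivity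
    have hx1 : (2 * (i : ℝ) + 1) * δ ^ 2 ≤ 1 := by
      refine le_trans ?_ hK3
      have := Finset.mem_range.1 hi
      have : 2 * i + 1 ≤ 2 * K := by omega
      have : (2 * i + 1 : ℝ) ≤ 2 * K := by exact_mod_cast this
      gcongr
    have h1 := antitoneOn_mul_bose hx (show (1 : ℝ) ∈ Set.Ioi 0 by simp) hx1
    have h2 := half_le_bose one_pos le_rfl
    simp only [one_mul] at h1
    have hb := bose_pos hx
    set b := bose ((2 * i + 1) * δ ^ 2)
    have h3 : 1 / 4 ≤ ((2 * (i : ℝ) + 1) * δ ^ 2 * b) ^ 2 := by nlinarith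
    rw [div_le_iff₀ (by positivity)]
    have : 0 ≤ (2 * (i : ℝ) + 1) ^ 2 * b * δ ^ 4 := by positivity
    nlinarith
  have hsum : (K : ℝ) * (1 / (2 * (δ ^ 2) ^ 2)) ≤ ∑ i ∈ Finset.range n, 2 * (2 * (i : ℝ) + 1) ^ 2 *
      (bose ((2 * i + 1) * δ ^ 2) + bose ((2 * i + 1) * δ ^ 2) ^ 2) := by
    calc (K : ℝ) * (1 / (2 * (δ ^ 2) ^ 2)) = ∑ i ∈ Finset.range K, 1 / (2 * (δ ^ 2) ^ 2) := by simp
      _ ≤ _ := Finset.sum_le_sum hterm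
      _ ≤ _ := by
        refine Finset.sum_le_sum_of_subset_of_nonneg (Finset.range_subset_range.2 hKn)
          fun i _ _ => ?_
        have := bose_pos (by positivity : 0 < (2 * (i : ℝ) + 1) * δ ^ 2)
        positivity
  calc (1 : ℝ) / 8 = δ ^ 6 * (1 / (4 * δ ^ 2) * (1 / (2 * (δ ^ 2) ^ 2))) := by
        field_simp; norm_num
    _ ≤ δ ^ 6 * (K * (1 / (2 * (δ ^ 2) ^ 2))) := by gcongr
    _ ≤ _ := by unfold normVar; gcongr

lemma one_le_two_mul_mul {δ : ℝ} (hδ : 0 < δ) (hδ' : δ ≤ 1 / 2) {n : ℕ}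
    (hn : n * δ ^ 4 = Real.pi ^ 2 / 6) : 1 ≤ 2 * n * δ ^ 2 := by
  have hpi := Real.pi_gt_three
  have h1 : 1 ≤ n * δ ^ 4 := by rw [hn]; nlinarith
  have h2 : n * δ ^ 4 ≤ n * δ ^ 2 := by
    gcongr 1
    exact pow_le_pow_of_le_one hδ.le (by linarith) (by norm_num)
  have : 0 ≤ n * δ ^ 2 := by positivity
  linarith

/-- Summing the cumulant expansions, the linear terms cancel the phase `e^(-inθ)` up to `|M - n|
δ³|t| ≤ 4δ|t|`, the quadratic ones give the variance, and the cubic errors total `6 · 37 · 2 ·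
δ|t|³`. -/
lemma pairChar_mul_exp_eq {δ t : ℝ} (hδ : 0 < δ) (hδt : δ * |t| ≤ 1 / 2) {n : ℕ}
    (hn : n * δ ^ 4 = Real.pi ^ 2 / 6) :
    ∃ e : ℂ, ‖e‖ ≤ δ * (444 * |t| ^ 3 + 4 * |t|) ∧
      pairChar (δ ^ 2) n (δ ^ 3 * t) * Complex.exp (-(n * (δ ^ 3 * t) : ℝ) * Complex.I) =
        Complex.exp (-(normVar δ n * t ^ 2 / 2 : ℝ) + e) := by
  have hw : 0 < δ ^ 2 := by positivity
  set m : ℕ → ℝ := fun i => bose ((2 * i + 1) * δ ^ 2) with hm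
  set y : ℕ → ℝ := fun i => (2 * i + 1) * (δ ^ 3 * t) with hy
  have hm0 : ∀ i, 0 < m i := fun i => bose_pos (by positivity)
  have hmy : ∀ i, m i * |y i| ≤ 1 / 2 := by
    intro i
    have h1 := mul_bose_mul_le (by positivity : (0 : ℝ) < 2 * i + 1) hw
    have h2 : Real.exp (-((2 * (i : ℝ) + 1) * δ ^ 2 / 2)) / δ ^ 2 ≤ 1 / δ ^ 2 := by
      gcongr
      refine Real.exp_le_one_iff.2 ?_
      rw [neg_nonpos]; positivity
    calc m i * |y i| = ((2 * i + 1) * m i) * (δ ^ 3 * |t|) := by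
          simp only [hy]
          rw [abs_mul, abs_mul, abs_of_pos (by positivity : (0 : ℝ) < 2 * i + 1),
            abs_of_pos (by positivity : 0 < δ ^ 3)]
          ring
      _ ≤ 1 / δ ^ 2 * (δ ^ 3 * |t|) := by gcongr; exact h1.trans h2
      _ = δ * |t| := by field_simp
      _ ≤ _ := hδt
  set L : ℕ → ℂ := fun i =>
    Complex.log ((1 - (m i : ℂ) * (Complex.exp (y i * Complex.I) - 1))⁻¹) with hL
  set T : ℕ → ℂ := fun i => m i * y i * Complex.I - (m i + m i ^ 2) * y i ^ 2 / 2 with hT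
  have hchar : pairChar (δ ^ 2) n (δ ^ 3 * t) = Complex.exp (∑ i ∈ Finset.range n, 2 * L i) := by
    rw [Complex.exp_sum, pairChar]
    refine Finset.prod_congr rfl fun i _ => ?_
    have hne : (1 - (m i : ℂ) * (Complex.exp (y i * Complex.I) - 1)) ≠ 0 := by
      intro h0
      have h1 := norm_sq_factor (m i) (y i)
      rw [h0, norm_zero] at h1
      have := Real.cos_le_one (y i)
      have : 0 ≤ 2 * m i * (1 + m i) * (1 - Real.cos (y i)) := by
        have := hm0 i
        have : 0 ≤ 1 - Real.cos (y i) := by linarith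
        positivity
      norm_num at h1
      linarith
    have h2 : Complex.exp (2 * L i) = Complex.exp (L i) ^ 2 := by
      rw [← Complex.exp_nat_mul]; norm_num
    rw [h2, Complex.exp_log (inv_ne_zero hne)]
  have hmean := abs_mean_sub_le hw (n := n) (by rw [← hn]; ring)
  set M := ∑ i ∈ Finset.range n, 2 * (2 * (i : ℝ) + 1) * bose ((2 * i + 1) * δ ^ 2) with hM
  have hTsum : ∑ i ∈ Finset.range n, 2 * T i = ((M * (δ ^ 3 * t) : ℝ) : ℂ) * Complex.I -
      ((normVar δ n * t ^ 2 / 2 : ℝ) : ℂ) := by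
    have e1 : ((M * (δ ^ 3 * t) : ℝ) : ℂ) = ∑ i ∈ Finset.range n, ((2 * (m i * y i) : ℝ) : ℂ) := by
      rw [← Complex.ofReal_sum, hM, Finset.sum_mul]
      congr 1
      exact Finset.sum_congr rfl fun i _ => by simp only [hm, hy]; ring
    have e2 : ((normVar δ n * t ^ 2 / 2 : ℝ) : ℂ) =
        ∑ i ∈ Finset.range n, (((m i + m i ^ 2) * y i ^ 2 : ℝ) : ℂ) := by
      rw [← Complex.ofReal_sum, normVar, Finset.mul_sum, Finset.sum_mul, Finset.sum_div]
      congr 1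
      exact Finset.sum_congr rfl fun i _ => by simp only [hm, hy]; ring
    rw [e1, e2, Finset.sum_mul, ← Finset.sum_sub_distrib]
    refine Finset.sum_congr rfl fun i _ => ?_
    simp only [hT]
    push_cast
    ring
  refine ⟨∑ i ∈ Finset.range n, 2 * (L i - T i) +
    (((M - n) * (δ ^ 3 * t) : ℝ) : ℂ) * Complex.I, ?_, ?_⟩
  · have h1 : ‖∑ i ∈ Finset.range n, 2 * (L i - T i)‖ ≤ δ * (444 * |t| ^ 3) := by
      calc ‖∑ i ∈ Finset.range n, 2 * (L i - T i)‖
          ≤ ∑ i ∈ Finset.range n, 6 * (37 / (δ ^ 2) ^ 3 * (δ ^ 3 * |t|) ^ 3) *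
              Real.exp (-((2 * i + 1) * (δ ^ 2 / 4))) := by
            refine norm_sum_le_of_le _ fun i _ => ?_
            have h2 := norm_log_factor_sub_le (hm0 i).le (hmy i)
            have h3 := cube_bose_le (by positivity : (0 : ℝ) < 2 * i + 1) hw
            have h4 : |y i| ^ 3 = (2 * i + 1) ^ 3 * (δ ^ 3 * |t|) ^ 3 := by
              simp only [hy]
              rw [abs_mul, abs_mul, abs_of_pos (by positivity : (0 : ℝ) < 2 * i + 1),
                abs_of_pos (by positivity : 0 < δ ^ 3), mul_pow]
            rw [norm_mul, Complex.norm_ofNat]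
            calc 2 * ‖L i - T i‖ ≤ 2 * (3 * ((m i + m i ^ 2 + m i ^ 3) * |y i| ^ 3)) := by
                  gcongr
              _ = 6 * (((m i + m i ^ 2 + m i ^ 3) * (2 * i + 1) ^ 3) * (δ ^ 3 * |t|) ^ 3) := by
                  rw [h4]; ring
              _ ≤ 6 * ((37 / (δ ^ 2) ^ 3 * Real.exp (-((2 * i + 1) * (δ ^ 2 / 4)))) *
                    (δ ^ 3 * |t|) ^ 3) := by
                  gcongr
              _ = _ := by ring
        _ ≤ 6 * (37 / (δ ^ 2) ^ 3 * (δ ^ 3 * |t|) ^ 3) * (1 / (2 * (δ ^ 2 / 4))) := by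
            rw [← Finset.mul_sum]
            gcongr
            exact sum_range_exp_odd_le (by positivity) n
        _ = δ * (444 * |t| ^ 3) := by field_simp; ring
    have h2 : ‖(((M - n) * (δ ^ 3 * t) : ℝ) : ℂ) * Complex.I‖ ≤ δ * (4 * |t|) := by
      rw [norm_mul, Complex.norm_I, mul_one, Complex.norm_real, Real.norm_eq_abs, abs_mul, abs_mul,
        abs_of_pos (by positivity : 0 < δ ^ 3)]
      calc |M - n| * (δ ^ 3 * |t|) ≤ 4 / δ ^ 2 * (δ ^ 3 * |t|) := by gcongr
        _ = δ * (4 * |t|) := by field_simp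
    refine (norm_add_le _ _).trans ?_
    linarith
  · rw [hchar, ← Complex.exp_add]
    congr 1
    have h1 : ∑ i ∈ Finset.range n, 2 * (L i - T i) =
        ∑ i ∈ Finset.range n, 2 * L i - ∑ i ∈ Finset.range n, 2 * T i := by
      rw [← Finset.sum_sub_distrib]
      exact Finset.sum_congr rfl fun i _ => by ring
    rw [h1, hTsum]
    push_cast
    ring

/-! ### The local limit theorem -/

/-- The scale `δ` with `δ ^ 2 = π / √(6 n)`. -/
noncomputable def scale (n : ℕ) : ℝ := √(Real.pi / √(6 * n))

lemma scale_pos {n : ℕ} (hn : 1 ≤ n) : 0 < scale n := by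
  have : (0 : ℝ) < n := by exact_mod_cast hn
  exact Real.sqrt_pos.2 (div_pos Real.pi_pos (Real.sqrt_pos.2 (by positivity)))

lemma scale_sq (n : ℕ) : scale n ^ 2 = Real.pi / √(6 * n) :=
  Real.sq_sqrt (div_nonneg Real.pi_pos.le (Real.sqrt_nonneg _))

lemma mul_scale_pow {n : ℕ} (hn : 1 ≤ n) : n * scale n ^ 4 = Real.pi ^ 2 / 6 := by
  have : (0 : ℝ) < n := by exact_mod_cast hn
  have e : scale n ^ 4 = (scale n ^ 2) ^ 2 := by ring
  rw [e, scale_sq, div_pow, Real.sq_sqrt (by positivity)]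
  field_simp

lemma tendsto_scale : Tendsto scale atTop (𝓝 0) := by
  have h1 : Tendsto (fun n : ℕ => √(6 * (n : ℝ))) atTop atTop :=
    Real.tendsto_sqrt_atTop.comp (tendsto_natCast_atTop_atTop.const_mul_atTop (by norm_num))
  have h2 := (Real.continuous_sqrt.tendsto 0).comp (h1.const_div_atTop Real.pi)
  rw [Real.sqrt_zero] at h2
  exact h2

lemma eventually_scale_le {c : ℝ} (hc : 0 < c) :
    ∀ᶠ n : ℕ in atTop, 1 ≤ n ∧ 0 < scale n ∧ scale n ≤ c := by
  filter_upwards [tendsto_scale.eventually (gt_mem_nhds hc), eventually_ge_atTop 1] with n h1 h2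
  exact ⟨h2, scale_pos h2, le_of_lt h1⟩

/-- The normalised number of pairs of partitions. -/
noncomputable def normCount (δ : ℝ) (I N : ℕ) : ℝ :=
  pairCount I N * Real.exp (-(N * δ ^ 2)) / pairVal (δ ^ 2) I * (2 * Real.pi) / δ ^ 3

lemma normCount_eq {δ : ℝ} (hδ : 0 < δ) (I N : ℕ) :
    (normCount δ I N : ℂ) = ∫ t, fourierKernel (δ ^ 2) (δ ^ 3) I N t := by
  have h := pairCount_eq_integral_kernel (by positivity : 0 < δ ^ 2) (by positivity : 0 < δ ^ 3) I N
  have hδ' : ((δ ^ 3 : ℝ) : ℂ) ≠ 0 := by exact_mod_cast (by positivity : δ ^ 3 ≠ 0)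
  rw [normCount, Complex.ofReal_div, div_eq_iff hδ', mul_comm (∫ t, _), ← h]
  push_cast
  ring

lemma norm_fourierKernel_le {δ : ℝ} (hδ : 0 < δ) (hδ' : δ ≤ 1 / 2) {I : ℕ}
    (hI : 1 ≤ 2 * I * δ ^ 2) (N : ℕ) (t : ℝ) :
    ‖fourierKernel (δ ^ 2) (δ ^ 3) I N t‖ ≤ 2 ^ 30 * (1 + t ^ 2)⁻¹ := by
  rw [fourierKernel]
  by_cases ht : t ∈ Set.Ioc (-(Real.pi / δ ^ 3)) (Real.pi / δ ^ 3)
  · rw [Set.indicator_of_mem ht, norm_mul, ← Complex.ofReal_neg, Complex.norm_exp_ofReal_mul_I,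
      mul_one, ← div_eq_mul_inv]
    refine norm_pairChar_le hδ hδ' hI ?_
    have h3 : 0 < δ ^ 3 := by positivity
    rw [abs_mul, abs_of_pos h3, mul_comm, ← le_div_iff₀ h3]
    exact abs_le.2 ⟨ht.1.le, ht.2⟩
  · rw [Set.indicator_of_notMem ht, norm_zero]
    positivity

lemma integrable_fourierKernel {δ : ℝ} (hδ : 0 < δ) (hδ' : δ ≤ 1 / 2) {I : ℕ}
    (hI : 1 ≤ 2 * I * δ ^ 2) (N : ℕ) : Integrable (fourierKernel (δ ^ 2) (δ ^ 3) I N) :=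
  Integrable.mono' (integrable_inv_one_add_sq.const_mul _)
    (measurable_fourierKernel _ _ _ _).aestronglyMeasurable
    (Eventually.of_forall (norm_fourierKernel_le hδ hδ' hI N))

lemma normCount_le {δ : ℝ} (hδ : 0 < δ) (hδ' : δ ≤ 1 / 2) {I : ℕ} (hI : 1 ≤ 2 * I * δ ^ 2)
    (N : ℕ) : normCount δ I N ≤ 2 ^ 32 := by
  have h : ‖(normCount δ I N : ℂ)‖ ≤ 2 ^ 30 * Real.pi := by
    rw [normCount_eq hδ, ← integral_univ_inv_one_add_sq, ← integral_const_mul]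
    exact norm_integral_le_of_norm_le (integrable_inv_one_add_sq.const_mul _)
      (Eventually.of_forall (norm_fourierKernel_le hδ hδ' hI N))
  rw [Complex.norm_real, Real.norm_eq_abs] at h
  have := le_abs_self (normCount δ I N)
  have := Real.pi_le_four
  linarith

/-- The Gaussian subtracted depends on `n`, since convergence of the variance is not established. -/
lemma tendsto_fourierKernel_sub (t : ℝ) :
    Tendsto (fun n : ℕ => fourierKernel (scale n ^ 2) (scale n ^ 3) n n t -
      Complex.exp (-(normVar (scale n) n * t ^ 2 / 2 : ℝ))) atTop (𝓝 0) := by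
  have hb' : Tendsto (fun n : ℕ => scale n * (444 * |t| ^ 3 + 4 * |t|)) atTop (𝓝 0) := by
    simpa using tendsto_scale.mul_const (444 * |t| ^ 3 + 4 * |t|)
  have hb : Tendsto (fun n : ℕ => 2 * (scale n * (444 * |t| ^ 3 + 4 * |t|))) atTop (𝓝 0) := by
    simpa using hb'.const_mul 2
  refine squeeze_zero_norm' ?_ hb
  have h1 : Tendsto (fun n => scale n * |t|) atTop (𝓝 0) := by
    simpa using tendsto_scale.mul_const |t|
  filter_upwards [eventually_scale_le (by norm_num : (0 : ℝ) < 1 / 2),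
    h1.eventually (ge_mem_nhds (by norm_num : (0 : ℝ) < 1 / 2)),
    hb'.eventually (ge_mem_nhds one_pos)] with n ⟨hn, hδ, hδ'⟩ hδt hle
  have hn4 := mul_scale_pow hn
  set δ := scale n
  have ht : t ∈ Set.Ioc (-(Real.pi / δ ^ 3)) (Real.pi / δ ^ 3) := by
    have hpi := Real.pi_gt_three
    have : |t| < Real.pi / δ ^ 3 := by
      rw [lt_div_iff₀ (by positivity)]
      calc |t| * δ ^ 3 = (δ * |t|) * δ ^ 2 := by ring
        _ ≤ 1 / 2 * 1 := by gcongr; exact pow_le_one₀ hδ.le (by linarith)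
        _ < Real.pi := by linarith
    exact ⟨(abs_lt.1 this).1, (abs_lt.1 this).2.le⟩
  rw [fourierKernel, Set.indicator_of_mem ht]
  obtain ⟨e, he, hE⟩ := pairChar_mul_exp_eq hδ hδt hn4
  rw [hE, Complex.exp_add, ← Complex.ofReal_neg, ← mul_sub_one, norm_mul, Complex.norm_exp_ofReal]
  have hV : 0 ≤ normVar δ n := by
    have := le_normVar hδ hδ' (one_le_two_mul_mul hδ hδ' hn4)
    linarith
  have h2 : Real.exp (-(normVar δ n * t ^ 2 / 2)) ≤ 1 := by
    refine Real.exp_le_one_iff.2 ?_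
    rw [neg_nonpos]; positivity
  calc _ ≤ 1 * (2 * ‖e‖) := by gcongr; exact Complex.norm_exp_sub_one_le (he.trans hle)
    _ ≤ _ := by rw [one_mul]; gcongr

/-- By dominated convergence `normCount` is within `1/4` of the Gaussian integral `√(2π/V)`, and
that integral is at least `1/2` because `V ≤ 20`. -/
lemma eventually_le_normCount : ∀ᶠ n : ℕ in atTop, 1 / 4 ≤ normCount (scale n) n n := by
  have hlim : Tendsto (fun n : ℕ => ∫ t, (fourierKernel (scale n ^ 2) (scale n ^ 3) n n t -
      Complex.exp (-(normVar (scale n) n * t ^ 2 / 2 : ℝ)))) atTop (𝓝 (∫ _ : ℝ, (0 : ℂ))) := by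
    refine tendsto_integral_filter_of_dominated_convergence
      -- The `16` dominates the Gaussians: `V ≥ 1/8` gives `e^(Vt²/2) ≥ 1 + t²/16`.
      (fun t => (2 ^ 30 + 16) * (1 + t ^ 2)⁻¹) ?_ ?_ (integrable_inv_one_add_sq.const_mul _)
      (Eventually.of_forall tendsto_fourierKernel_sub)
    · refine Eventually.of_forall fun n => ?_
      exact ((measurable_fourierKernel _ _ _ _).sub (by fun_prop)).aestronglyMeasurable
    · filter_upwards [eventually_scale_le (by norm_num : (0 : ℝ) < 1 / 2)] with n ⟨hn, hδ, hδ'⟩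
      have hI := one_le_two_mul_mul hδ hδ' (mul_scale_pow hn)
      refine Eventually.of_forall fun t => (norm_sub_le _ _).trans ?_
      rw [add_mul]
      refine add_le_add (norm_fourierKernel_le hδ hδ' hI n t) ?_
      rw [← Complex.ofReal_neg, Complex.norm_exp_ofReal, Real.exp_neg, ← div_eq_mul_inv,
        inv_le_comm₀ (Real.exp_pos _) (by positivity), inv_div]
      have hV := le_normVar hδ hδ' hI
      have h1 := Real.add_one_le_exp (normVar (scale n) n * t ^ 2 / 2)
      have h2 : 1 / 8 * t ^ 2 ≤ normVar (scale n) n * t ^ 2 := by gcongr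
      linarith
  rw [integral_zero] at hlim
  have h0 := (tendsto_zero_iff_norm_tendsto_zero.1 hlim).eventually
    (ge_mem_nhds (by norm_num : (0 : ℝ) < 1 / 4))
  filter_upwards [h0, eventually_scale_le (by norm_num : (0 : ℝ) < 1 / 2)] with n h ⟨hn, hδ, hδ'⟩
  have hI := one_le_two_mul_mul hδ hδ' (mul_scale_pow hn)
  have hV := le_normVar hδ hδ' hI
  have hV2 := normVar_le hδ n
  have hg : (fun t : ℝ => Complex.exp (-(normVar (scale n) n * t ^ 2 / 2 : ℝ))) =
      fun t : ℝ => ((Real.exp (-(normVar (scale n) n / 2) * t ^ 2) : ℝ) : ℂ) := by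
    funext t
    rw [Complex.ofReal_exp]
    congr 1
    push_cast
    ring
  have hgi : Integrable (fun t : ℝ => ((Real.exp (-(normVar (scale n) n / 2) * t ^ 2) : ℝ) : ℂ)) :=
    (integrable_exp_neg_mul_sq (by linarith)).ofReal
  rw [integral_sub (integrable_fourierKernel hδ hδ' hI n) (by rw [hg]; exact hgi),
    ← normCount_eq hδ, hg, integral_complex_ofReal, integral_gaussian, ← Complex.ofReal_sub,
    Complex.norm_real, Real.norm_eq_abs] at h
  have hs : 1 / 2 ≤ √(Real.pi / (normVar (scale n) n / 2)) := by
    refine Real.le_sqrt_of_sq_le ?_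
    have := Real.pi_gt_three
    rw [le_div_iff₀ (by linarith)]
    linarith
  have := (abs_le.1 h).1
  linarith

/-! ### Stability of the local limit under removal of large parts -/

lemma bose_le_two_mul_exp {x : ℝ} (hx : 1 ≤ x) : bose x ≤ 2 * Real.exp (-x) := by
  have h : 2 ≤ Real.exp x := by
    have := Real.add_one_le_exp x
    linarith
  rw [bose, Real.exp_neg, ← div_eq_mul_inv, inv_le_comm₀ (by linarith) (by positivity), inv_div]
  linarith

/-- The two functions differ by the factor `P² = ∏ (1 - u_i)²` over the removed parts, with `|P - 1|
≤ e^(∑|u_i|) - 1`. A quarter of the decay of `bose x` is spent on absorbing the factor `x`, whence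
the exponent `3/2` in place of `2`. -/
lemma norm_pairChar_sub_le {δ : ℝ} (hδ : 0 < δ) {I n : ℕ} (hIn : I ≤ n) (hI : 1 ≤ 2 * I * δ ^ 2)
    (t : ℝ) {η : ℝ}
    (hη : η = Real.exp (6 * |t| * (Real.exp (-(3 / 2 * I * δ ^ 2)) / δ)) - 1) :
    ‖pairChar (δ ^ 2) I (δ ^ 3 * t) - pairChar (δ ^ 2) n (δ ^ 3 * t)‖ ≤ η * (η + 2) := by
  have hw : 0 < δ ^ 2 := by positivity
  set θ := δ ^ 3 * t with hθ
  set u : ℕ → ℂ := fun i => (bose ((2 * i + 1) * δ ^ 2) : ℂ) *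
    (Complex.exp (((2 * i + 1) * θ : ℝ) * Complex.I) - 1) with hu
  have hsum : ∑ i ∈ Finset.Ico I n, ‖-u i‖ ≤
      6 * |t| * (Real.exp (-(3 / 2 * I * δ ^ 2)) / δ) := by
    calc ∑ i ∈ Finset.Ico I n, ‖-u i‖
        ≤ ∑ i ∈ Finset.Ico I n, (8 / δ ^ 2 * (δ ^ 3 * |t|)) *
            Real.exp (-((2 * i + 1) * (3 / 4 * δ ^ 2))) := by
          refine Finset.sum_le_sum fun i hi => ?_
          have hi' : (2 * I : ℝ) ≤ 2 * i + 1 := by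
            have := (Finset.mem_Ico.1 hi).1
            have : 2 * I ≤ 2 * i + 1 := by omega
            exact_mod_cast this
          have hx : 1 ≤ (2 * i + 1) * δ ^ 2 := hI.trans (by gcongr)
          have hx0 : 0 < (2 * i + 1) * δ ^ 2 := by linarith
          have hb := bose_le_two_mul_exp hx
          have hb0 := (bose_pos hx0).le
          have h1 : ((2 * i + 1) * δ ^ 2) * bose ((2 * i + 1) * δ ^ 2) ≤
              8 * Real.exp (-((2 * i + 1) * (3 / 4 * δ ^ 2))) := by
            set x := (2 * i + 1) * δ ^ 2
            have h2 := Real.add_one_le_exp (x / 4)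
            calc x * bose x ≤ (4 * Real.exp (x / 4)) * (2 * Real.exp (-x)) := by
                  gcongr; linarith
              _ = 8 * (Real.exp (x / 4) * Real.exp (-x)) := by ring
              _ = _ := by
                rw [← Real.exp_add]
                congr 2
                simp only [x]
                ring
          have h3 := norm_exp_mul_I_sub_one_le ((2 * i + 1) * θ)
          rw [abs_mul, abs_of_pos (by positivity : (0 : ℝ) < 2 * i + 1), hθ, abs_mul,
            abs_of_pos (by positivity : 0 < δ ^ 3)] at h3
          rw [norm_neg, hu]
          simp only [norm_mul, Complex.norm_real, Real.norm_of_nonneg hb0]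
          calc _ ≤ bose ((2 * i + 1) * δ ^ 2) * ((2 * i + 1) * (δ ^ 3 * |t|)) := by gcongr
            _ = (((2 * i + 1) * δ ^ 2) * bose ((2 * i + 1) * δ ^ 2)) / δ ^ 2 * (δ ^ 3 * |t|) := by
              field_simp
            _ ≤ (8 * Real.exp (-((2 * i + 1) * (3 / 4 * δ ^ 2)))) / δ ^ 2 * (δ ^ 3 * |t|) := by
              gcongr
            _ = _ := by ring
      _ ≤ (8 / δ ^ 2 * (δ ^ 3 * |t|)) * (Real.exp (-(2 * I * (3 / 4 * δ ^ 2))) /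
            (2 * (3 / 4 * δ ^ 2))) := by
          rw [← Finset.mul_sum]
          gcongr
          exact sum_Ico_exp_odd_le (by positivity) I n
      _ = 16 / 3 * |t| * (Real.exp (-(3 / 2 * I * δ ^ 2)) / δ) := by
          rw [show 2 * (I : ℝ) * (3 / 4 * δ ^ 2) = 3 / 2 * I * δ ^ 2 by ring]
          field_simp
          ring
      _ ≤ _ := by gcongr; norm_num
  have hP : ‖∏ i ∈ Finset.Ico I n, (1 + -u i) - 1‖ ≤ η := by
    refine (Finset.norm_prod_one_add_sub_one_le _ _).trans ?_
    rw [hη]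
    gcongr
  set P := ∏ i ∈ Finset.Ico I n, (1 + -u i)
  have hne : ∀ i, 1 - u i ≠ 0 := by
    intro i h0
    have h1 := norm_sq_factor (bose ((2 * i + 1) * δ ^ 2)) ((2 * i + 1) * θ)
    have h2 : ‖1 - u i‖ ^ 2 = 0 := by rw [h0]; simp
    rw [hu] at h2
    simp only at h2
    rw [h2] at h1
    have := Real.cos_le_one ((2 * i + 1) * θ)
    have := bose_pos (by positivity : 0 < (2 * (i : ℝ) + 1) * δ ^ 2)
    have : 0 ≤ 2 * bose ((2 * i + 1) * δ ^ 2) * (1 + bose ((2 * i + 1) * δ ^ 2)) *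
        (1 - Real.cos ((2 * i + 1) * θ)) := by
      have : 0 ≤ 1 - Real.cos ((2 * i + 1) * θ) := by linarith
      positivity
    linarith
  have hsplit : pairChar (δ ^ 2) I θ = pairChar (δ ^ 2) n θ * P ^ 2 := by
    have e1 : pairChar (δ ^ 2) n θ = pairChar (δ ^ 2) I θ *
        ∏ i ∈ Finset.Ico I n, ((1 - u i)⁻¹) ^ 2 := by
      rw [pairChar, pairChar, Finset.prod_range_mul_prod_Ico _ hIn]
    have e2 : (∏ i ∈ Finset.Ico I n, ((1 - u i)⁻¹) ^ 2) * P ^ 2 = 1 := by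
      rw [← Finset.prod_pow, ← Finset.prod_mul_distrib]
      refine Finset.prod_eq_one fun i _ => ?_
      rw [← mul_pow, ← sub_eq_add_neg, inv_mul_cancel₀ (hne i), one_pow]
    rw [e1, mul_assoc, e2, mul_one]
  have hη0 : 0 ≤ η := (norm_nonneg _).trans hP
  have e3 : pairChar (δ ^ 2) I θ - pairChar (δ ^ 2) n θ =
      pairChar (δ ^ 2) n θ * ((P - 1) * ((P - 1) + 2)) := by rw [hsplit]; ring
  rw [e3, norm_mul, norm_mul]
  have h5 : ‖P - 1 + 2‖ ≤ η + 2 := by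
    refine (norm_add_le _ _).trans ?_
    rw [Complex.norm_ofNat]
    linarith
  calc _ ≤ 1 * (η * (η + 2)) := by
        gcongr
        exact norm_pairChar_le_one hw θ n
    _ = _ := one_mul _

/-- Discarding parts that are too large to occur often does not change the local limit. -/
lemma tendsto_normCount_sub {I : ℕ → ℕ} {A : ℝ} (hIn : ∀ᶠ n in atTop, I n ≤ n)
    (hA : ∀ᶠ n in atTop, Real.exp (-(2 * I n * scale n ^ 2)) ≤ A * scale n ^ 2) :
    Tendsto (fun n => normCount (scale n) (I n) n - normCount (scale n) n n) atTop (𝓝 0) := by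
  have hA0 : Tendsto (fun n => A * scale n ^ 2) atTop (𝓝 0) := by
    simpa using (tendsto_scale.pow 2).const_mul A
  have hI1 : ∀ᶠ n in atTop, 1 ≤ 2 * I n * scale n ^ 2 := by
    filter_upwards [hA, hA0.eventually (ge_mem_nhds (Real.exp_pos (-1)))] with n h1 h2
    have := Real.exp_le_exp.1 (h1.trans h2)
    linarith
  -- The `3/4`-th power of `e^(-2Iw) ≤ Aδ²` is `O(δ^(3/2))`, still `o(δ)`.
  have hr : Tendsto (fun n => Real.exp (-(3 / 2 * I n * scale n ^ 2)) / scale n) atTop (𝓝 0) := by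
    have h1 : Tendsto (fun n => √A * √(√(A * scale n ^ 2))) atTop (𝓝 0) := by
      have := (Real.continuous_sqrt.comp Real.continuous_sqrt).tendsto 0
      simpa using ((this.comp hA0).const_mul √A)
    refine squeeze_zero' ?_ ?_ h1
    · filter_upwards [eventually_ge_atTop 1] with n hn
      have := scale_pos hn
      positivity
    · filter_upwards [hA, eventually_ge_atTop 1] with n hn h1
      have hδ := scale_pos h1
      set δ := scale n
      set x := (I n : ℝ) * δ ^ 2
      have e1 : Real.exp (-x) ≤ √(A * δ ^ 2) := by
        refine Real.le_sqrt_of_sq_le ?_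
        rw [← Real.exp_nat_mul]
        convert hn using 2
        simp only [x]; push_cast; ring
      have e2 : Real.exp (-(x / 2)) ≤ √(√(A * δ ^ 2)) := by
        refine Real.le_sqrt_of_sq_le ?_
        rw [← Real.exp_nat_mul]
        convert e1 using 2
        push_cast; ring
      have e3 : √(A * δ ^ 2) = √A * δ := by
        rw [mul_comm, Real.sqrt_mul (by positivity), Real.sqrt_sq hδ.le, mul_comm]
      rw [div_le_iff₀ hδ]
      calc Real.exp (-(3 / 2 * I n * δ ^ 2)) = Real.exp (-x) * Real.exp (-(x / 2)) := by
            rw [← Real.exp_add]; congr 1; simp only [x]; ring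
        _ ≤ √(A * δ ^ 2) * √(√(A * δ ^ 2)) := by gcongr
        _ = √A * √(√(A * δ ^ 2)) * δ := by rw [e3]; ring
  have hlim : Tendsto (fun n : ℕ => ∫ t, (fourierKernel (scale n ^ 2) (scale n ^ 3) (I n) n t -
      fourierKernel (scale n ^ 2) (scale n ^ 3) n n t)) atTop (𝓝 (∫ _ : ℝ, (0 : ℂ))) := by
    refine tendsto_integral_filter_of_dominated_convergence
      (fun t => (2 ^ 30 + 2 ^ 30) * (1 + t ^ 2)⁻¹) ?_ ?_ (integrable_inv_one_add_sq.const_mul _)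
      (Eventually.of_forall fun t => ?_)
    · refine Eventually.of_forall fun n => ?_
      exact ((measurable_fourierKernel _ _ _ _).sub
        (measurable_fourierKernel _ _ _ _)).aestronglyMeasurable
    · filter_upwards [eventually_scale_le (by norm_num : (0 : ℝ) < 1 / 2), hI1] with
        n ⟨hn, hδ, hδ'⟩ hI
      have hI' := one_le_two_mul_mul hδ hδ' (mul_scale_pow hn)
      refine Eventually.of_forall fun t => (norm_sub_le _ _).trans ?_
      rw [add_mul]
      exact add_le_add (norm_fourierKernel_le hδ hδ' hI n t) (norm_fourierKernel_le hδ hδ' hI' n t)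
    · have hη : Tendsto (fun n => Real.exp (6 * |t| * (Real.exp (-(3 / 2 * I n * scale n ^ 2)) /
          scale n)) - 1) atTop (𝓝 0) := by
        have := ((Real.continuous_exp.tendsto _).comp (hr.const_mul (6 * |t|))).sub_const 1
        simpa using this
      have hη2 := hη.mul (hη.add_const 2)
      rw [zero_mul] at hη2
      refine squeeze_zero_norm' ?_ hη2
      filter_upwards [eventually_scale_le (by norm_num : (0 : ℝ) < 1 / 2), hI1, hIn] with
        n ⟨hn, hδ, hδ'⟩ hI hIn
      have hb := norm_pairChar_sub_le hδ hIn hI t rfl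
      rw [fourierKernel, fourierKernel]
      by_cases ht : t ∈ Set.Ioc (-(Real.pi / scale n ^ 3)) (Real.pi / scale n ^ 3)
      · rw [Set.indicator_of_mem ht, Set.indicator_of_mem ht, ← sub_mul, norm_mul,
          ← Complex.ofReal_neg, Complex.norm_exp_ofReal_mul_I, mul_one]
        exact hb
      · rw [Set.indicator_of_notMem ht, Set.indicator_of_notMem ht, sub_self, norm_zero]
        exact (norm_nonneg _).trans hb
  rw [integral_zero] at hlim
  have h2 : Tendsto (fun n => ((normCount (scale n) (I n) n - normCount (scale n) n n : ℝ) : ℂ))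
      atTop (𝓝 ((0 : ℝ) : ℂ)) := by
    rw [Complex.ofReal_zero]
    refine hlim.congr' ?_
    filter_upwards [eventually_scale_le (by norm_num : (0 : ℝ) < 1 / 2), hI1] with n ⟨hn, hδ, hδ'⟩ hI
    have hI' := one_le_two_mul_mul hδ hδ' (mul_scale_pow hn)
    rw [integral_sub (integrable_fourierKernel hδ hδ' hI n) (integrable_fourierKernel hδ hδ' hI' n),
      ← normCount_eq hδ, ← normCount_eq hδ, Complex.ofReal_sub]
  exact (Complex.continuous_re.tendsto _).comp h2

/-! ### Limit and tails of the number of pairs with bounded parts -/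

open OddUnimodalSeq (oddIndex)

lemma pairCount_eq_normCount {δ : ℝ} (hδ : 0 < δ) (I N : ℕ) :
    (pairCount I N : ℝ) =
      normCount δ I N * pairVal (δ ^ 2) I * (δ ^ 3 / (2 * Real.pi)) * Real.exp (N * δ ^ 2) := by
  have h1 := (pairVal_pos (by positivity : 0 < δ ^ 2) I).ne'
  have h2 := Real.pi_pos
  rw [normCount, Real.exp_neg]
  field_simp

lemma pairVal_eq_mul {w : ℝ} (hw : 0 < w) {I n : ℕ} (hIn : I ≤ n) :
    pairVal w I = pairVal w n *
      ∏ i ∈ Finset.Ico I n, (1 - Real.exp (-((2 * i + 1) * w))) ^ 2 := by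
  have e : pairVal w n = pairVal w I *
      ∏ i ∈ Finset.Ico I n, ((1 - Real.exp (-((2 * i + 1) * w)))⁻¹) ^ 2 := by
    rw [pairVal, pairVal, Finset.prod_range_mul_prod_Ico _ hIn]
  rw [e, mul_assoc, ← Finset.prod_mul_distrib, Finset.prod_eq_one, mul_one]
  intro i _
  have : 0 < 1 - Real.exp (-((2 * i + 1) * w)) := by
    rw [sub_pos, Real.exp_lt_one_iff, neg_lt_zero]
    positivity
  rw [← mul_pow, inv_mul_cancel₀ this.ne', one_pow]

lemma prod_one_sub_exp_le {w : ℝ} (hw : 0 < w) (I n : ℕ) :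
    ∏ i ∈ Finset.Ico I n, (1 - Real.exp (-((2 * i + 1) * w))) ^ 2 ≤
      Real.exp (-(2 * ∑ i ∈ Finset.Ico I n, Real.exp (-((2 * i + 1) * w)))) := by
  rw [Finset.mul_sum, ← Finset.sum_neg_distrib, Real.exp_sum]
  refine Finset.prod_le_prod (fun _ _ => sq_nonneg _) fun i _ => ?_
  have h1 : Real.exp (-((2 * i + 1) * w)) ≤ 1 := by
    rw [Real.exp_le_one_iff, neg_nonpos]; positivity
  have h2 := Real.add_one_le_exp (-Real.exp (-((2 * i + 1) * w)))
  have e : Real.exp (-(2 * Real.exp (-((2 * i + 1) * w)))) =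
      Real.exp (-Real.exp (-((2 * i + 1) * w))) ^ 2 := by
    rw [← Real.exp_nat_mul]; congr 1; push_cast; ring
  rw [e]
  gcongr
  linarith

/-- From `(1 - p)⁻¹ ≤ e^(p/(1-p₀))` for `p ≤ p₀`. Since `p₀ = e^(-2Iw)` tends to `0` at the relevant
level, this matches `prod_one_sub_exp_le` in the limit. -/
lemma le_prod_one_sub_exp {w : ℝ} (hw : 0 < w) {I : ℕ} (n : ℕ)
    (hI : Real.exp (-(2 * I * w)) < 1) :
    Real.exp (-(2 * ((∑ i ∈ Finset.Ico I n, Real.exp (-((2 * i + 1) * w))) /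
      (1 - Real.exp (-(2 * I * w)))))) ≤
      ∏ i ∈ Finset.Ico I n, (1 - Real.exp (-((2 * i + 1) * w))) ^ 2 := by
  rw [Finset.sum_div, Finset.mul_sum, ← Finset.sum_neg_distrib, Real.exp_sum]
  refine Finset.prod_le_prod (fun _ _ => (Real.exp_pos _).le) fun i hi => ?_
  have h1 : Real.exp (-((2 * i + 1) * w)) ≤ Real.exp (-(2 * I * w)) := by
    have := (Finset.mem_Ico.1 hi).1
    have : 2 * I ≤ 2 * i + 1 := by omega
    have : (2 * I : ℝ) ≤ 2 * i + 1 := by exact_mod_cast this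
    gcongr
  set p := Real.exp (-((2 * i + 1) * w)) with hp
  have hp0 : 0 < p := Real.exp_pos _
  set p₀ := Real.exp (-(2 * I * w))
  have h2 : (1 - p)⁻¹ ≤ Real.exp (p / (1 - p₀)) := by
    have h3 : p / (1 - p) ≤ p / (1 - p₀) := by gcongr
    have h4 : (1 - p)⁻¹ = p / (1 - p) + 1 := by
      have : 1 - p ≠ 0 := by linarith
      field_simp; ring
    have := Real.add_one_le_exp (p / (1 - p₀))
    linarith
  have e : Real.exp (-(2 * (p / (1 - p₀)))) = (Real.exp (p / (1 - p₀)) ^ 2)⁻¹ := by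
    rw [Real.exp_neg, ← Real.exp_nat_mul]; norm_num
  have h5 : 0 < 1 - p := by linarith
  rw [e, inv_le_comm₀ (by positivity) (by positivity), ← inv_pow]
  gcongr

/-- The value of the peak at the rescaled position `v`. -/
noncomputable def level (n : ℕ) (v : ℝ) : ℝ :=
  (Real.log (2 / scale n ^ 2) + v) / scale n ^ 2

lemma exp_neg_level {n : ℕ} (hn : 1 ≤ n) (v : ℝ) :
    Real.exp (-(level n v * scale n ^ 2)) = scale n ^ 2 / 2 * Real.exp (-v) := by
  have hδ := scale_pos hn
  rw [level, div_mul_cancel₀ _ (by positivity), neg_add, Real.exp_add, Real.exp_neg,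
    Real.exp_log (by positivity), inv_div]

lemma lt_oddIndex (y : ℝ) : y - 1 < 2 * oddIndex y := by
  have := Nat.lt_floor_add_one ((y + 1) / 2)
  rw [oddIndex]
  linarith

lemma oddIndex_le {y : ℝ} (hy : -1 ≤ y) : 2 * (oddIndex y : ℝ) ≤ y + 1 := by
  have := Nat.floor_le (by linarith : 0 ≤ (y + 1) / 2)
  rw [oddIndex]
  linarith

lemma oddIndex_le_of_le {n : ℕ} (hn : 1 ≤ n) {y : ℝ}
    (h : y * scale n ^ 2 + scale n ^ 2 ≤ 3 / scale n ^ 2) : oddIndex y ≤ n := by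
  have hδ := scale_pos hn
  have hn4 := mul_scale_pow hn
  have hpi := Real.pi_gt_three
  refine Nat.floor_le_of_le ?_
  have h1 : (y + 1) * scale n ^ 4 ≤ 3 := by
    calc (y + 1) * scale n ^ 4 = (y * scale n ^ 2 + scale n ^ 2) * scale n ^ 2 := by ring
      _ ≤ 3 / scale n ^ 2 * scale n ^ 2 := by gcongr
      _ = 3 := by field_simp
  -- Here `2n δ⁴ = π²/3 ≥ 3`.
  have h2 : (y + 1) * scale n ^ 4 ≤ (2 * n) * scale n ^ 4 := by nlinarith
  have := le_of_mul_le_mul_right h2 (by positivity)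
  linarith

lemma exp_neg_two_mul_scale_le {n : ℕ} (hn : 1 ≤ n) :
    Real.exp (-(2 * n * scale n ^ 2)) ≤ scale n ^ 4 := by
  have hδ := scale_pos hn
  have hn4 := mul_scale_pow hn
  have hpi := Real.pi_gt_three
  have h := Real.quadratic_le_exp_of_nonneg (by positivity : 0 ≤ 2 * n * scale n ^ 2)
  have h0 : 0 < 2 * n * scale n ^ 2 := by
    have : (0 : ℝ) < n := by exact_mod_cast hn
    positivity
  rw [Real.exp_neg, inv_le_comm₀ (Real.exp_pos _) (by positivity)]
  refine le_trans ?_ h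
  rw [inv_eq_one_div, div_le_iff₀ (by positivity)]
  have : (2 * n * scale n ^ 2) ^ 2 / 2 * scale n ^ 4 = 2 * (n * scale n ^ 4) ^ 2 := by ring
  have h2 : 1 ≤ n * scale n ^ 4 := by rw [hn4]; nlinarith
  have h3 : 1 ≤ (2 * n * scale n ^ 2) ^ 2 / 2 * scale n ^ 4 := by rw [this]; nlinarith
  refine h3.trans ?_
  gcongr
  linarith

/-- Rounding the level to an odd integer changes the exponential by a factor between `e^(-w)` and
`e^w`. -/
lemma tendsto_exp_oddIndex_level (v : ℝ) :
    Tendsto (fun n => Real.exp (-(2 * oddIndex (level n v) * scale n ^ 2)) / scale n ^ 2) atTop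
      (𝓝 (Real.exp (-v) / 2)) := by
  have hw : Tendsto (fun n => scale n ^ 2) atTop (𝓝 0) := by simpa using tendsto_scale.pow 2
  have h1 : Tendsto (fun n => Real.exp (-v) / 2 * Real.exp (-(scale n ^ 2))) atTop
      (𝓝 (Real.exp (-v) / 2)) := by
    have := ((Real.continuous_exp.tendsto _).comp hw.neg).const_mul (Real.exp (-v) / 2)
    simpa using this
  have h2 : Tendsto (fun n => Real.exp (-v) / 2 * Real.exp (scale n ^ 2)) atTop
      (𝓝 (Real.exp (-v) / 2)) := by
    have := ((Real.continuous_exp.tendsto _).comp hw).const_mul (Real.exp (-v) / 2)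
    simpa using this
  have hlog : ∀ᶠ n in atTop, 0 ≤ Real.log (2 / scale n ^ 2) + v := by
    filter_upwards [eventually_scale_le (by norm_num : (0 : ℝ) < 1 / 2),
      hw.eventually (ge_mem_nhds (by positivity : 0 < 2 * Real.exp v))] with n ⟨hn, hδ, _⟩ h
    have : -v ≤ Real.log (2 / scale n ^ 2) := by
      rw [Real.le_log_iff_exp_le (by positivity), Real.exp_neg, le_div_iff₀ (by positivity),
        inv_mul_le_iff₀ (Real.exp_pos _), mul_comm]
      exact h
    linarith
  refine tendsto_of_tendsto_of_tendsto_of_le_of_le' h1 h2 ?_ ?_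
  · filter_upwards [hlog, eventually_ge_atTop 1] with n h hn
    have hδ := scale_pos hn
    have hy : 0 ≤ level n v := div_nonneg h (by positivity)
    have h3 := oddIndex_le (by linarith : -1 ≤ level n v)
    rw [le_div_iff₀ (by positivity)]
    calc Real.exp (-v) / 2 * Real.exp (-(scale n ^ 2)) * scale n ^ 2
        = Real.exp (-(level n v * scale n ^ 2)) * Real.exp (-(scale n ^ 2)) := by
          rw [exp_neg_level hn]; ring
      _ = Real.exp (-((level n v + 1) * scale n ^ 2)) := by
          rw [← Real.exp_add]; congr 1; ring
      _ ≤ _ := by gcongr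
  · filter_upwards [eventually_ge_atTop 1] with n hn
    have hδ := scale_pos hn
    have h3 := lt_oddIndex (level n v)
    rw [div_le_iff₀ (by positivity)]
    calc Real.exp (-(2 * oddIndex (level n v) * scale n ^ 2))
        ≤ Real.exp (-((level n v - 1) * scale n ^ 2)) := by gcongr
      _ = Real.exp (-(level n v * scale n ^ 2)) * Real.exp (scale n ^ 2) := by
          rw [← Real.exp_add]; congr 1; ring
      _ = _ := by rw [exp_neg_level hn]; ring

lemma eventually_oddIndex_level_le (v : ℝ) : ∀ᶠ n in atTop, oddIndex (level n v) ≤ n := by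
  have hw : Tendsto (fun n => scale n ^ 2 * (v + scale n ^ 2)) atTop (𝓝 0) := by
    have h := tendsto_scale.pow 2
    simpa using h.mul (h.const_add v)
  filter_upwards [hw.eventually (ge_mem_nhds one_pos), eventually_ge_atTop 1] with n h hn
  have hδ := scale_pos hn
  refine oddIndex_le_of_le hn ?_
  rw [level, div_mul_cancel₀ _ (by positivity)]
  have h1 := Real.log_le_sub_one_of_pos (by positivity : 0 < 2 / scale n ^ 2)
  have h2 : v + scale n ^ 2 ≤ 1 / scale n ^ 2 := by
    rw [le_div_iff₀ (by positivity)]; linarith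
  have h3 : 3 / scale n ^ 2 = 2 / scale n ^ 2 + 1 / scale n ^ 2 := by ring
  linarith

/-- The geometric sum equals `(e^(-2Iw) - e^(-2nw))/(2 sinh w)`, where `sinh w ~ w`, `e^(-2Iw) ~ w
e^(-v)/2`, and the end term is `O(w²)`. -/
lemma tendsto_sum_exp_level (v : ℝ) :
    Tendsto (fun n => ∑ i ∈ Finset.Ico (oddIndex (level n v)) n,
      Real.exp (-((2 * i + 1) * scale n ^ 2))) atTop (𝓝 (Real.exp (-v) / 4)) := by
  have hw : Tendsto (fun n => scale n ^ 2) atTop (𝓝 0) := by simpa using tendsto_scale.pow 2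
  have hw' : Tendsto (fun n => scale n ^ 2) atTop (𝓝[≠] 0) := by
    refine tendsto_nhdsWithin_iff.2 ⟨hw, ?_⟩
    filter_upwards [eventually_ge_atTop 1] with n hn
    have := scale_pos hn
    exact (by positivity : scale n ^ 2 ≠ 0)
  have hsinh : Tendsto (fun n => Real.sinh (scale n ^ 2) / scale n ^ 2) atTop (𝓝 1) := by
    have h := (hasDerivAt_iff_tendsto_slope.1 (Real.hasDerivAt_sinh 0)).comp hw'
    rw [Real.cosh_zero] at h
    refine h.congr fun n => ?_
    simp [slope_def_field]
  have h2n : Tendsto (fun n : ℕ => Real.exp (-(2 * n * scale n ^ 2)) / scale n ^ 2) atTop (𝓝 0) := by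
    refine squeeze_zero' (Eventually.of_forall fun n => by positivity) ?_ hw
    filter_upwards [eventually_ge_atTop 1] with n hn
    have hδ := scale_pos hn
    rw [div_le_iff₀ (by positivity)]
    refine (exp_neg_two_mul_scale_le hn).trans (le_of_eq (by ring))
  have h := ((tendsto_exp_oddIndex_level v).sub h2n).div (hsinh.const_mul 2) (by norm_num)
  have e : (Real.exp (-v) / 2 - 0) / (2 * 1) = Real.exp (-v) / 4 := by ring
  rw [e] at h
  refine h.congr' ?_
  filter_upwards [eventually_oddIndex_level_le v, eventually_ge_atTop 1] with n hI hn
  have hδ := scale_pos hn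
  have hs : 0 < Real.sinh (scale n ^ 2) := Real.sinh_pos_iff.2 (by positivity)
  rw [sum_Ico_exp_odd (by positivity) hI]
  simp only [Pi.div_apply]
  field_simp

lemma tendsto_prod_level (v : ℝ) :
    Tendsto (fun n => ∏ i ∈ Finset.Ico (oddIndex (level n v)) n,
      (1 - Real.exp (-((2 * i + 1) * scale n ^ 2))) ^ 2) atTop
      (𝓝 (Real.exp (-(1 / 2) * Real.exp (-v)))) := by
  have hw : Tendsto (fun n => scale n ^ 2) atTop (𝓝 0) := by simpa using tendsto_scale.pow 2
  have hS := tendsto_sum_exp_level v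
  have hp : Tendsto (fun n => Real.exp (-(2 * oddIndex (level n v) * scale n ^ 2))) atTop
      (𝓝 0) := by
    have := (tendsto_exp_oddIndex_level v).mul hw
    rw [mul_zero] at this
    refine this.congr' ?_
    filter_upwards [eventually_ge_atTop 1] with n hn
    have hδ := scale_pos hn
    field_simp
  have h1 := (Real.continuous_exp.tendsto _).comp
    ((hS.div (hp.const_sub 1) (by norm_num)).const_mul 2).neg
  have h2 := (Real.continuous_exp.tendsto _).comp (hS.const_mul 2).neg
  have e1 : -(2 * (Real.exp (-v) / 4 / (1 - 0))) = -(1 / 2) * Real.exp (-v) := by ring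
  have e2 : -(2 * (Real.exp (-v) / 4)) = -(1 / 2) * Real.exp (-v) := by ring
  rw [e1] at h1
  rw [e2] at h2
  refine tendsto_of_tendsto_of_tendsto_of_le_of_le' h1 h2 ?_ ?_
  · filter_upwards [hp.eventually (gt_mem_nhds one_pos), eventually_ge_atTop 1] with n h hn
    have hδ := scale_pos hn
    exact le_prod_one_sub_exp (by positivity) n h
  · filter_upwards [eventually_ge_atTop 1] with n hn
    have hδ := scale_pos hn
    exact prod_one_sub_exp_le (by positivity) _ n

lemma pairCount_div_eq {n : ℕ} (hn : 1 ≤ n) {I : ℕ} (hI : I ≤ n) :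
    (pairCount I n : ℝ) / pairCount n n =
      (∏ i ∈ Finset.Ico I n, (1 - Real.exp (-((2 * i + 1) * scale n ^ 2))) ^ 2) *
        (normCount (scale n) I n / normCount (scale n) n n) := by
  have hδ := scale_pos hn
  have hQ := (pairVal_pos (by positivity : 0 < scale n ^ 2) n).ne'
  have hpi := Real.pi_pos
  rw [pairCount_eq_normCount hδ I n, pairCount_eq_normCount hδ n n,
    pairVal_eq_mul (by positivity) hI]
  field_simp

/-- The limit law of the largest part of a random pair of partitions. -/
lemma tendsto_pairCount_div (v : ℝ) :
    Tendsto (fun n => (pairCount (oddIndex (level n v)) n : ℝ) / pairCount n n) atTop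
      (𝓝 (Real.exp (-(1 / 2) * Real.exp (-v)))) := by
  have hsub := tendsto_normCount_sub (I := fun n => oddIndex (level n v)) (A := Real.exp (-v))
    (eventually_oddIndex_level_le v) (by
      have hlt : Real.exp (-v) / 2 < Real.exp (-v) := half_lt_self (Real.exp_pos _)
      filter_upwards [(tendsto_exp_oddIndex_level v).eventually (ge_mem_nhds hlt),
        eventually_ge_atTop 1] with n h hn
      have hδ := scale_pos hn
      rwa [div_le_iff₀ (by positivity)] at h)
  have hratio : Tendsto (fun n => normCount (scale n) (oddIndex (level n v)) n /
      normCount (scale n) n n) atTop (𝓝 1) := by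
    have h0 : Tendsto (fun n => (normCount (scale n) (oddIndex (level n v)) n -
        normCount (scale n) n n) / normCount (scale n) n n) atTop (𝓝 0) := by
      have h4 := (hsub.norm).const_mul 4
      rw [norm_zero, mul_zero] at h4
      refine squeeze_zero_norm' ?_ h4
      filter_upwards [eventually_le_normCount] with n hn
      rw [norm_div, Real.norm_of_nonneg (by linarith : 0 ≤ normCount (scale n) n n),
        div_le_iff₀ (by linarith)]
      have := norm_nonneg (normCount (scale n) (oddIndex (level n v)) n - normCount (scale n) n n)
      nlinarith
    have h1 := h0.const_add 1
    rw [add_zero] at h1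
    refine h1.congr' ?_
    filter_upwards [eventually_le_normCount] with n hn
    have : normCount (scale n) n n ≠ 0 := by linarith
    field_simp
    ring
  have h := (tendsto_prod_level v).mul hratio
  rw [mul_one] at h
  refine h.congr' ?_
  filter_upwards [eventually_oddIndex_level_le v, eventually_ge_atTop 1] with n hI hn
  rw [pairCount_div_eq hn hI]

lemma eventually_pairCount_pos : ∀ᶠ n in atTop, 0 < pairCount n n := by
  filter_upwards [eventually_le_normCount, eventually_ge_atTop 1] with n h hn
  have hδ := scale_pos hn
  have h1 : 0 < normCount (scale n) n n := by linarith
  have := pairVal_pos (by positivity : 0 < scale n ^ 2) n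
  have hp : (0 : ℝ) < pairCount n n := by
    rw [pairCount_eq_normCount hδ]
    have := Real.pi_pos
    positivity
  exact_mod_cast hp

/-- The upper bound on `normCount` is uniform in the size, so lowering the size by `k` at fixed `w`
costs `e^(-kw)`; `2^34` is `2^32` divided by `1/4`. -/
lemma eventually_shiftCount_le : ∀ᶠ n in atTop, ∀ k, (shiftCount n n k : ℝ) ≤
    2 ^ 34 * Real.exp (-(k * scale n ^ 2)) * pairCount n n := by
  filter_upwards [eventually_le_normCount, eventually_scale_le (by norm_num : (0 : ℝ) < 1 / 2)] with
    n h ⟨hn, hδ, hδ'⟩ k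
  have hI := one_le_two_mul_mul hδ hδ' (mul_scale_pow hn)
  rw [shiftCount]
  split_ifs with hk
  · have hQ := pairVal_pos (by positivity : 0 < scale n ^ 2) n
    have hpi := Real.pi_pos
    rw [pairCount_eq_normCount hδ n (n - k), pairCount_eq_normCount hδ n n, Nat.cast_sub hk]
    have h1 := normCount_le hδ hδ' hI (n - k)
    have e : Real.exp ((n - k : ℝ) * scale n ^ 2) =
        Real.exp (-(k * scale n ^ 2)) * Real.exp (n * scale n ^ 2) := by
      rw [← Real.exp_add]; congr 1; ring
    rw [e]
    have h2 : normCount (scale n) n (n - k) ≤ 2 ^ 34 * normCount (scale n) n n := by linarith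
    calc _ ≤ (2 ^ 34 * normCount (scale n) n n) * pairVal (scale n ^ 2) n *
          (scale n ^ 3 / (2 * Real.pi)) *
          (Real.exp (-(k * scale n ^ 2)) * Real.exp (n * scale n ^ 2)) := by gcongr
      _ = _ := by ring
  · push_cast
    positivity

lemma shiftCount_mono {I J : ℕ} (h : I ≤ J) (n k : ℕ) : shiftCount I n k ≤ shiftCount J n k := by
  rw [shiftCount, shiftCount]
  split_ifs
  · exact pairCount_mono _ h
  · exact le_rfl

/-- Pairs of partitions with equal largest parts are negligible. -/
lemma tendsto_equalCount_div :
    Tendsto (fun n => (equalCount n n : ℝ) / pairCount n n) atTop (𝓝 0) := by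
  refine tendsto_order.2 ⟨fun a ha => Eventually.of_forall fun n => ha.trans_le (by positivity),
    fun ε hε => ?_⟩
  -- This `v` makes the limit law `e^(-4/ε) < ε`. Below the level, equal largest parts are no more
  -- frequent than pairs with small parts. Above it, two copies of a large part cost `e^(-2kw)`
  -- each, in total `O(e^(-4Iw)/w) = O(w)`.
  set v := Real.log (ε / 8) with hv
  have hev : Real.exp (-v) = 8 / ε := by rw [Real.exp_neg, hv, Real.exp_log (by positivity), inv_div]
  have hG : Real.exp (-(1 / 2) * Real.exp (-v)) < ε := by
    rw [hev, show -(1 / 2) * (8 / ε) = -(4 / ε) by ring, Real.exp_neg,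
      inv_lt_comm₀ (Real.exp_pos _) hε]
    have := Real.add_one_le_exp (4 / ε)
    have h1 : ε⁻¹ ≤ 4 / ε := by rw [inv_eq_one_div]; gcongr; norm_num
    linarith
  have hw : Tendsto (fun n => scale n ^ 2) atTop (𝓝 0) := by simpa using tendsto_scale.pow 2
  have hE := tendsto_exp_oddIndex_level v
  have hlim := (tendsto_pairCount_div v).add (((hE.mul hE).mul hw).const_mul (2 ^ 32))
  rw [mul_zero, mul_zero, add_zero] at hlim
  filter_upwards [hlim.eventually (gt_mem_nhds hG), eventually_pairCount_pos,
    eventually_shiftCount_le, eventually_oddIndex_level_le v, eventually_ge_atTop 1] with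
    n h1 hp hs hI hn
  refine lt_of_le_of_lt ?_ h1
  have hδ := scale_pos hn
  have hp' : (0 : ℝ) < pairCount n n := by exact_mod_cast hp
  set I := oddIndex (level n v)
  have e1 : (equalCount I n : ℝ) ≤ pairCount I n := by
    have h2 := two_mul_peakCount hn I
    have h3 := peakCount_le n I
    have : equalCount I n ≤ pairCount I n := by omega
    exact_mod_cast this
  have e2 : (equalCount n n : ℝ) = equalCount I n +
      ∑ i ∈ Finset.Ico I n, (shiftCount (i + 1) n (2 * (2 * i + 1)) : ℝ) := by
    rw [equalCount, equalCount, Nat.cast_sum, Nat.cast_sum, Finset.sum_range_add_sum_Ico _ hI]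
  have e3 : ∑ i ∈ Finset.Ico I n, (shiftCount (i + 1) n (2 * (2 * i + 1)) : ℝ) ≤
      ∑ i ∈ Finset.Ico I n, 2 ^ 34 * pairCount n n *
        Real.exp (-((2 * i + 1) * (2 * scale n ^ 2))) := by
    refine Finset.sum_le_sum fun i hi => ?_
    have h4 : (shiftCount (i + 1) n (2 * (2 * i + 1)) : ℝ) ≤ shiftCount n n (2 * (2 * i + 1)) := by
      exact_mod_cast shiftCount_mono (Finset.mem_Ico.1 hi).2 n _
    refine (h4.trans (hs _)).trans (le_of_eq ?_)
    push_cast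
    ring_nf
  have e4 : ∑ i ∈ Finset.Ico I n, Real.exp (-((2 * i + 1) * (2 * scale n ^ 2))) ≤
      Real.exp (-(2 * I * scale n ^ 2)) * Real.exp (-(2 * I * scale n ^ 2)) / (4 * scale n ^ 2) := by
    refine (sum_Ico_exp_odd_le (by positivity) I n).trans (le_of_eq ?_)
    rw [← Real.exp_add]
    ring_nf
  rw [div_le_iff₀ hp', e2]
  rw [← Finset.mul_sum] at e3
  have e5 := mul_le_mul_of_nonneg_left e4 (by positivity : (0 : ℝ) ≤ 2 ^ 34 * pairCount n n)
  have e6 : (pairCount I n / pairCount n n + 2 ^ 32 * (Real.exp (-(2 * I * scale n ^ 2)) /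
      scale n ^ 2 * (Real.exp (-(2 * I * scale n ^ 2)) / scale n ^ 2) * scale n ^ 2)) *
      (pairCount n n : ℝ) = pairCount I n + 2 ^ 34 * pairCount n n *
        (Real.exp (-(2 * I * scale n ^ 2)) * Real.exp (-(2 * I * scale n ^ 2)) /
          (4 * scale n ^ 2)) := by
    field_simp
    ring
  rw [e6]
  linarith

lemma tendsto_peakCount_div (v : ℝ) :
    Tendsto (fun n => (peakCount (oddIndex (level n v)) n : ℝ) / peakCount n n) atTop
      (𝓝 (Real.exp (-(1 / 2) * Real.exp (-v)))) := by
  have he := tendsto_equalCount_div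
  have hI : Tendsto (fun n => (equalCount (oddIndex (level n v)) n : ℝ) / pairCount n n) atTop
      (𝓝 0) := by
    refine squeeze_zero' (Eventually.of_forall fun n => by positivity) ?_ he
    filter_upwards [eventually_oddIndex_level_le v] with n h
    have : equalCount (oddIndex (level n v)) n ≤ equalCount n n :=
      Finset.sum_le_sum_of_subset (Finset.range_subset_range.2 h)
    gcongr
  have h := ((tendsto_pairCount_div v).add hI).div (he.const_add 1) (by norm_num)
  rw [add_zero, add_zero, div_one] at h
  refine h.congr' ?_
  filter_upwards [eventually_pairCount_pos, eventually_ge_atTop 1] with n hp hn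
  have h1 : (2 : ℝ) * peakCount (oddIndex (level n v)) n =
      pairCount (oddIndex (level n v)) n + equalCount (oddIndex (level n v)) n := by
    exact_mod_cast two_mul_peakCount hn _
  have h2 : (2 : ℝ) * peakCount n n = pairCount n n + equalCount n n := by
    exact_mod_cast two_mul_peakCount hn _
  have hp' : (0 : ℝ) < pairCount n n := by exact_mod_cast hp
  have h3 : (0 : ℝ) ≤ equalCount n n := by positivity
  simp only [Pi.div_apply]
  rw [← mul_div_mul_left (peakCount _ n : ℝ) _ (two_ne_zero : (2 : ℝ) ≠ 0), h1, h2]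
  have : (pairCount n n : ℝ) + equalCount n n ≠ 0 := by positivity
  field_simp

/-! ### Tail bounds uniform in the level -/

lemma pairCount_le_two_mul_peakCount {n : ℕ} (hn : 1 ≤ n) :
    (pairCount n n : ℝ) ≤ 2 * peakCount n n := by
  have h2 : (2 : ℝ) * peakCount n n = pairCount n n + equalCount n n := by
    exact_mod_cast two_mul_peakCount hn _
  have h3 : (0 : ℝ) ≤ equalCount n n := by positivity
  linarith

/-- Union bound over peaks above `y`, each costing `e^(-kw)`. Uniformity in `y` is what dominated
convergence for the mean requires. -/
lemma eventually_one_sub_peakCount_div_le : ∀ᶠ n in atTop, ∀ y : ℝ,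
    1 - (peakCount (oddIndex y) n : ℝ) / peakCount n n ≤
      2 ^ 36 * (Real.exp (-(y * scale n ^ 2)) / scale n ^ 2) := by
  filter_upwards [eventually_pairCount_pos, eventually_shiftCount_le,
    eventually_scale_le (by norm_num : (0 : ℝ) < 1 / 2)] with n hp hs ⟨hn, hδ, hδ'⟩ y
  have hp' : (0 : ℝ) < pairCount n n := by exact_mod_cast hp
  have hpk := pairCount_le_two_mul_peakCount hn
  have hpk0 : (0 : ℝ) < peakCount n n := by linarith
  set I := oddIndex y
  rcases le_total n I with h | h
  · have : (peakCount n n : ℝ) ≤ peakCount I n := by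
      exact_mod_cast Finset.sum_le_sum_of_subset (Finset.range_subset_range.2 h)
    have h1 : 1 ≤ (peakCount I n : ℝ) / peakCount n n := by rwa [one_le_div hpk0]
    have : 0 ≤ 2 ^ 36 * (Real.exp (-(y * scale n ^ 2)) / scale n ^ 2) := by positivity
    linarith
  · have e2 : (peakCount n n : ℝ) = peakCount I n +
        ∑ i ∈ Finset.Ico I n, (shiftCount (i + 1) n (2 * i + 1) : ℝ) := by
      rw [peakCount, peakCount, Nat.cast_sum, Nat.cast_sum, Finset.sum_range_add_sum_Ico _ h]
    have e3 : ∑ i ∈ Finset.Ico I n, (shiftCount (i + 1) n (2 * i + 1) : ℝ) ≤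
        ∑ i ∈ Finset.Ico I n, 2 ^ 34 * pairCount n n *
          Real.exp (-((2 * i + 1) * scale n ^ 2)) := by
      refine Finset.sum_le_sum fun i hi => ?_
      have h4 : (shiftCount (i + 1) n (2 * i + 1) : ℝ) ≤ shiftCount n n (2 * i + 1) := by
        exact_mod_cast shiftCount_mono (Finset.mem_Ico.1 hi).2 n _
      refine (h4.trans (hs _)).trans (le_of_eq ?_)
      push_cast
      ring
    have e4 : Real.exp (-(2 * I * scale n ^ 2)) ≤ 4 * Real.exp (-(y * scale n ^ 2)) := by
      have h5 := lt_oddIndex y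
      have h6 : Real.exp (scale n ^ 2) ≤ 4 := by
        have h7 : scale n ^ 2 ≤ 1 := pow_le_one₀ hδ.le (by linarith)
        have := Real.exp_le_exp.2 h7
        have := Real.exp_one_lt_d9
        linarith
      calc Real.exp (-(2 * I * scale n ^ 2)) ≤ Real.exp (-((y - 1) * scale n ^ 2)) := by gcongr
        _ = Real.exp (scale n ^ 2) * Real.exp (-(y * scale n ^ 2)) := by
          rw [← Real.exp_add]; congr 1; ring
        _ ≤ _ := by gcongr
    have e5 := sum_Ico_exp_odd_le (by positivity : 0 < scale n ^ 2) I n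
    rw [← Finset.mul_sum] at e3
    have e6 : 1 - (peakCount I n : ℝ) / peakCount n n =
        (∑ i ∈ Finset.Ico I n, (shiftCount (i + 1) n (2 * i + 1) : ℝ)) / peakCount n n := by
      rw [eq_div_iff hpk0.ne', sub_mul, div_mul_cancel₀ _ hpk0.ne']
      linarith
    rw [e6, div_le_iff₀ hpk0]
    calc _ ≤ 2 ^ 34 * (2 * peakCount n n) *
          (4 * Real.exp (-(y * scale n ^ 2)) / (2 * scale n ^ 2)) := by
          refine e3.trans ?_
          gcongr
          exact e5.trans (by gcongr)
      _ = _ := by field_simp; norm_num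

lemma two_mul_sinh_le {w : ℝ} (hw : 0 ≤ w) (hw' : w ≤ 1 / 2) : 2 * Real.sinh w ≤ 3 * w := by
  have h1 := Real.exp_bound_div_one_sub_of_interval hw (by linarith : w < 1)
  have h2 : 1 / (1 - w) ≤ 1 + 2 * w := by
    rw [div_le_iff₀ (by linarith)]; nlinarith
  have h3 := Real.add_one_le_exp (-w)
  rw [Real.sinh_eq]
  linarith

/-- The generating function ratio decays doubly exponentially in the lower tail; `e^(-u) ≤ 1/u`
reduces this to the simple exponential that suffices. The hypothesis on `y` says that the rescaled
position is at most `0`. -/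
lemma eventually_peakCount_div_le : ∀ᶠ n in atTop, ∀ y : ℝ,
    y * scale n ^ 2 ≤ Real.log (2 / scale n ^ 2) →
    (peakCount (oddIndex y) n : ℝ) / peakCount n n ≤
      2 ^ 43 * (scale n ^ 2 * Real.exp (y * scale n ^ 2)) := by
  filter_upwards [eventually_pairCount_pos, eventually_le_normCount,
    eventually_scale_le (by norm_num : (0 : ℝ) < 1 / 2)] with n hp hN ⟨hn, hδ, hδ'⟩ y hy
  have hp' : (0 : ℝ) < pairCount n n := by exact_mod_cast hp
  have hpk := pairCount_le_two_mul_peakCount hn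
  have hpk0 : (0 : ℝ) < peakCount n n := by linarith
  have hw : 0 < scale n ^ 2 := by positivity
  have hw4 : scale n ^ 2 ≤ 1 / 4 := by nlinarith
  have hsmall := exp_neg_two_mul_scale_le hn
  have hN2 : ∀ I : ℕ, 1 ≤ 2 * I * scale n ^ 2 → normCount (scale n) I n ≤ 2 ^ 32 :=
    fun I hI => normCount_le hδ hδ' hI n
  rcases lt_or_ge y 1 with hy1 | hy1
  · have : oddIndex y = 0 := Nat.floor_eq_zero.2 (by linarith)
    rw [this]
    simp only [peakCount, Finset.range_zero, Finset.sum_empty, Nat.cast_zero, zero_div]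
    positivity
  have hquot : 3 / scale n ^ 2 = 2 / scale n ^ 2 + 1 / scale n ^ 2 := by ring
  have hinv : 4 ≤ 1 / scale n ^ 2 := by rw [le_div_iff₀ hw]; linarith
  have hinv2 : 8 ≤ 2 / scale n ^ 2 := by rw [le_div_iff₀ hw]; linarith
  -- Raising the level to `2/w` makes `2Iw ≥ 1`, as the bound on `normCount` requires, at the price
  -- of a factor `e² ≤ 9` in `e^(zw)`.
  set z := max y (2 / scale n ^ 2) with hz
  have hzw : z * scale n ^ 2 = max (y * scale n ^ 2) 2 := by
    rw [hz, max_mul_of_nonneg _ _ hw.le, div_mul_cancel₀ _ hw.ne']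
  have hIn : oddIndex z ≤ n := by
    refine oddIndex_le_of_le hn ?_
    rw [hzw]
    have h1 := Real.log_le_sub_one_of_pos (by positivity : 0 < 2 / scale n ^ 2)
    have : max (y * scale n ^ 2) 2 ≤ 2 / scale n ^ 2 := max_le (by linarith) (by linarith)
    linarith
  have hI1 : 1 ≤ 2 * (oddIndex z : ℝ) * scale n ^ 2 := by
    have h1 := lt_oddIndex z
    have h2 : 2 ≤ z * scale n ^ 2 := by rw [hzw]; exact le_max_right _ _
    calc (1 : ℝ) ≤ z * scale n ^ 2 - scale n ^ 2 := by linarith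
      _ = (z - 1) * scale n ^ 2 := by ring
      _ ≤ _ := by gcongr
  have hIle : 2 * (oddIndex z : ℝ) ≤ z + 1 := oddIndex_le (by
    have : y ≤ z := le_max_left _ _
    linarith)
  have hmono : (peakCount (oddIndex y) n : ℝ) ≤ pairCount (oddIndex z) n := by
    have h1 : oddIndex y ≤ oddIndex z := Nat.floor_mono (by
      have : y ≤ z := le_max_left _ _
      linarith)
    exact_mod_cast (peakCount_le n _).trans (pairCount_mono n h1)
  set I := oddIndex z
  set S := ∑ i ∈ Finset.Ico I n, Real.exp (-((2 * i + 1) * scale n ^ 2)) with hSdef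
  set X := Real.exp (-(z * scale n ^ 2)) with hX
  have hX0 : 0 < X := Real.exp_pos _
  have hS : X / (6 * scale n ^ 2) - 1 ≤ S := by
    have hs0 : 0 < Real.sinh (scale n ^ 2) := Real.sinh_pos_iff.2 hw
    have hs := two_mul_sinh_le hw.le (by linarith)
    have h1 : X / 2 ≤ Real.exp (-(2 * I * scale n ^ 2)) := by
      calc X / 2 = X * (1 / 2) := by ring
        _ ≤ X * Real.exp (-(scale n ^ 2)) := by
          gcongr
          have := Real.add_one_le_exp (-(scale n ^ 2))
          linarith
        _ = Real.exp (-((z + 1) * scale n ^ 2)) := by rw [hX, ← Real.exp_add]; congr 1; ring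
        _ ≤ _ := by gcongr
    have h2 : Real.exp (-(2 * n * scale n ^ 2)) ≤ Real.exp (-(2 * I * scale n ^ 2)) := by gcongr
    rw [hSdef, sum_Ico_exp_odd hw hIn]
    calc X / (6 * scale n ^ 2) - 1 ≤ (X / 2 - scale n ^ 4) / (3 * scale n ^ 2) := by
          rw [sub_div]
          have e1 : X / 2 / (3 * scale n ^ 2) = X / (6 * scale n ^ 2) := by field_simp; norm_num
          have e2 : scale n ^ 4 / (3 * scale n ^ 2) ≤ 1 := by
            rw [div_le_one (by positivity)]
            nlinarith
          linarith
      _ ≤ (Real.exp (-(2 * I * scale n ^ 2)) - Real.exp (-(2 * n * scale n ^ 2))) /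
            (3 * scale n ^ 2) := by gcongr
      _ ≤ _ := by
        refine div_le_div_of_nonneg_left (by linarith) (by positivity) hs
  have hprod := prod_one_sub_exp_le hw I n
  rw [← hSdef] at hprod
  have h2 : Real.exp 2 ≤ 9 := by
    have e : Real.exp 2 = Real.exp 1 ^ 2 := by rw [← Real.exp_nat_mul]; norm_num
    have := Real.exp_one_lt_d9
    have := Real.exp_pos 1
    rw [e]; nlinarith
  have hexp : Real.exp (-(2 * S)) ≤ 9 * (3 * scale n ^ 2 * Real.exp (z * scale n ^ 2)) := by
    have h1 : Real.exp (-(2 * S)) ≤ Real.exp 2 * Real.exp (-(X / (3 * scale n ^ 2))) := by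
      rw [← Real.exp_add]
      gcongr
      have : X / (3 * scale n ^ 2) = 2 * (X / (6 * scale n ^ 2)) := by field_simp; norm_num
      linarith
    have h3 : Real.exp (-(X / (3 * scale n ^ 2))) ≤ 3 * scale n ^ 2 * Real.exp (z * scale n ^ 2) := by
      have h4 : 3 * scale n ^ 2 * Real.exp (z * scale n ^ 2) = (X / (3 * scale n ^ 2))⁻¹ := by
        rw [hX, Real.exp_neg]; field_simp
      rw [h4, Real.exp_neg]
      refine inv_anti₀ (by positivity) ?_
      have := Real.add_one_le_exp (X / (3 * scale n ^ 2))
      linarith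
    calc _ ≤ _ := h1
      _ ≤ _ := by gcongr
  have hez : Real.exp (z * scale n ^ 2) ≤ 9 * Real.exp (y * scale n ^ 2) := by
    have h1 : 1 ≤ Real.exp (y * scale n ^ 2) := Real.one_le_exp (by positivity)
    rw [hzw]
    rcases max_cases (y * scale n ^ 2) 2 with h | h <;> rw [h.1] <;> linarith
  have hratio : (pairCount I n : ℝ) / pairCount n n ≤ Real.exp (-(2 * S)) * 2 ^ 34 := by
    rw [pairCount_div_eq hn hIn]
    have h1 : normCount (scale n) I n / normCount (scale n) n n ≤ 2 ^ 34 := by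
      rw [div_le_iff₀ (by linarith)]
      have := hN2 I hI1
      linarith
    have h0 : 0 ≤ ∏ i ∈ Finset.Ico I n, (1 - Real.exp (-((2 * i + 1) * scale n ^ 2))) ^ 2 :=
      Finset.prod_nonneg fun _ _ => sq_nonneg _
    calc _ ≤ (∏ i ∈ Finset.Ico I n, (1 - Real.exp (-((2 * i + 1) * scale n ^ 2))) ^ 2) * 2 ^ 34 := by
          gcongr
      _ ≤ _ := by gcongr
  calc (peakCount (oddIndex y) n : ℝ) / peakCount n n
      ≤ pairCount I n / (pairCount n n / 2) := by
        gcongr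
        linarith
    _ = 2 * (pairCount I n / pairCount n n) := by field_simp
    _ ≤ 2 * ((9 * (3 * scale n ^ 2 * (9 * Real.exp (y * scale n ^ 2)))) * 2 ^ 34) := by
        gcongr
        refine hratio.trans ?_
        gcongr
        exact hexp.trans (by gcongr)
    _ ≤ _ := by
        have : 0 ≤ scale n ^ 2 * Real.exp (y * scale n ^ 2) := by positivity
        nlinarith

/-! ### The mean of the limit law -/

lemma integral_eq_integral_tails {Ω : Type*} [MeasurableSpace Ω] {μ : Measure Ω} {X : Ω → ℝ}
    (hX : Integrable X μ) :
    ∫ ω, X ω ∂μ = (∫ t in Set.Ioi 0, μ.real {ω | t < X ω}) -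
      ∫ t in Set.Ioi 0, μ.real {ω | X ω ≤ -t} := by
  have h1 : ∫ ω, X ω ∂μ = ∫ ω, max (X ω) 0 ∂μ - ∫ ω, max (-X ω) 0 ∂μ := by
    rw [← integral_sub hX.pos_part hX.neg_part]
    refine integral_congr_ae (Eventually.of_forall fun ω => ?_)
    rcases le_total 0 (X ω) with h | h
    · simp [h]
    · simp [h]
  rw [h1, hX.pos_part.integral_eq_integral_meas_lt (Eventually.of_forall fun _ => le_max_right _ _),
    hX.neg_part.integral_eq_integral_meas_le (Eventually.of_forall fun _ => le_max_right _ _)]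
  congr 1
  · refine setIntegral_congr_fun measurableSet_Ioi fun t ht => ?_
    have ht' : 0 < t := ht
    refine congrArg μ.real (Set.ext fun ω => ?_)
    simp [ht'.not_gt]
  · refine setIntegral_congr_fun measurableSet_Ioi fun t ht => ?_
    have ht' : 0 < t := ht
    refine congrArg μ.real (Set.ext fun ω => ?_)
    simp only [Set.mem_ofPred_eq, le_max_iff, ht'.not_ge, or_false]
    exact le_neg

/-- This is `Γ'(1) = -γ`, with Euler's integral differentiated under the integral sign. -/
lemma integral_log_mul_exp :
    ∫ t in Set.Ioi (0 : ℝ), Real.log t * Real.exp (-t) = -Real.eulerMascheroniConstant := by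
  have h1 := Complex.hasDerivAt_GammaIntegral (s := 1) (by norm_num)
  have h2 : HasDerivAt Complex.GammaIntegral (-Real.eulerMascheroniConstant : ℂ) 1 := by
    refine Complex.hasDerivAt_Gamma_one.congr_of_eventuallyEq ?_
    have : {s : ℂ | 0 < s.re} ∈ 𝓝 (1 : ℂ) :=
      (isOpen_lt continuous_const Complex.continuous_re).mem_nhds (by simp)
    filter_upwards [this] with s hs
    exact (Complex.Gamma_eq_integral hs).symm
  have h3 := h1.unique h2
  have h4 : ∫ t : ℝ in Set.Ioi 0, (t : ℂ) ^ ((1 : ℂ) - 1) * (Real.log t * Real.exp (-t)) =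
      ((∫ t in Set.Ioi (0 : ℝ), Real.log t * Real.exp (-t) : ℝ) : ℂ) := by
    rw [← integral_complex_ofReal]
    refine setIntegral_congr_fun measurableSet_Ioi fun t ht => ?_
    simp
  rw [h4] at h3
  exact_mod_cast h3

lemma integrableOn_log_mul_exp :
    IntegrableOn (fun t => Real.log t * Real.exp (-t)) (Set.Ioi (0 : ℝ)) := by
  -- A non-integrable function has integral `0` by convention, but the integral is `-γ ≠ 0`.
  by_contra h
  have h1 := integral_log_mul_exp
  rw [integral_undef h] at h1
  have := Real.one_half_lt_eulerMascheroniConstant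
  linarith

/-- The standard exponential distribution. -/
noncomputable def stdExp : Measure ℝ :=
  (volume.restrict (Set.Ioi 0)).withDensity fun t => ENNReal.ofReal (Real.exp (-t))

lemma integrable_stdExp_iff {f : ℝ → ℝ} :
    Integrable f stdExp ↔ IntegrableOn (fun t => f t * Real.exp (-t)) (Set.Ioi 0) := by
  rw [stdExp, integrable_withDensity_iff (by fun_prop) (by simp)]
  simp only [ENNReal.toReal_ofReal (Real.exp_pos _).le]
  rfl

lemma integral_stdExp (f : ℝ → ℝ) :
    ∫ t, f t ∂stdExp = ∫ t in Set.Ioi 0, f t * Real.exp (-t) := by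
  rw [stdExp, integral_withDensity_eq_integral_toReal_smul (by fun_prop) (by simp)]
  refine integral_congr_ae (Eventually.of_forall fun t => ?_)
  simp only [ENNReal.toReal_ofReal (Real.exp_pos _).le, smul_eq_mul]
  ring

lemma integrableOn_exp_neg : IntegrableOn (fun t : ℝ => Real.exp (-t)) (Set.Ioi 0) := by
  simpa using integrableOn_exp_mul_Ioi (a := -1) (by norm_num) 0

lemma stdExp_real {S : Set ℝ} (hS : MeasurableSet S) (hS0 : S ⊆ Set.Ioi 0) :
    stdExp.real S = ∫ t in S, Real.exp (-t) := by
  have h := integral_stdExp (S.indicator 1)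
  rw [integral_indicator_one hS] at h
  rw [h]
  have : (fun t => S.indicator (1 : ℝ → ℝ) t * Real.exp (-t)) =
      S.indicator fun t => Real.exp (-t) := by
    funext t
    by_cases ht : t ∈ S <;> simp [ht]
  rw [this, setIntegral_indicator hS, Set.inter_eq_self_of_subset_right hS0]

lemma stdExp_real_inter (S : Set ℝ) : stdExp.real S = stdExp.real (S ∩ Set.Ioi 0) := by
  rw [measureReal_def, measureReal_def]
  congr 1
  refine measure_congr ?_
  have h : ∀ᵐ t ∂stdExp, t ∈ Set.Ioi (0 : ℝ) :=
    (withDensity_absolutelyContinuous _ _).ae_le (ae_restrict_mem measurableSet_Ioi)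
  filter_upwards [h] with t ht
  exact propext ⟨fun h => ⟨h, ht⟩, fun h => h.1⟩

lemma stdExp_lt (t : ℝ) : stdExp.real {x | t < -Real.log (2 * x)} =
    1 - Real.exp (-(1 / 2) * Real.exp (-t)) := by
  have e : {x | t < -Real.log (2 * x)} ∩ Set.Ioi 0 = Set.Ioo 0 (Real.exp (-t) / 2) := by
    ext x
    simp only [Set.mem_inter_iff, Set.mem_ofPred_eq, Set.mem_Ioi, Set.mem_Ioo]
    constructor
    · rintro ⟨h1, h2⟩
      refine ⟨h2, ?_⟩
      have := (Real.log_lt_iff_lt_exp (by positivity)).1 (lt_neg.1 h1)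
      linarith
    · rintro ⟨h1, h2⟩
      exact ⟨lt_neg.2 ((Real.log_lt_iff_lt_exp (by positivity)).2 (by linarith)), h1⟩
  rw [stdExp_real_inter, e, stdExp_real measurableSet_Ioo fun x hx => hx.1,
    ← integral_Ioc_eq_integral_Ioo, ← intervalIntegral.integral_of_le (by positivity)]
  have h := intervalIntegral.integral_comp_neg (a := 0) (b := Real.exp (-t) / 2) Real.exp
  rw [h, integral_exp]
  simp
  ring_nf

lemma stdExp_le (t : ℝ) : stdExp.real {x | -Real.log (2 * x) ≤ -t} =
    Real.exp (-(1 / 2) * Real.exp (-(-t))) := by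
  have e : {x | -Real.log (2 * x) ≤ -t} ∩ Set.Ioi 0 = Set.Ici (Real.exp t / 2) := by
    ext x
    simp only [Set.mem_inter_iff, Set.mem_ofPred_eq, Set.mem_Ioi, Set.mem_Ici, neg_le_neg_iff]
    constructor
    · rintro ⟨h1, h2⟩
      have := (Real.le_log_iff_exp_le (by positivity)).1 h1
      linarith
    · intro h1
      have h2 : 0 < x := lt_of_lt_of_le (by positivity) h1
      exact ⟨(Real.le_log_iff_exp_le (by positivity)).2 (by linarith), h2⟩
  have hsub : Set.Ici (Real.exp t / 2) ⊆ Set.Ioi 0 := fun x hx =>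
    lt_of_lt_of_le (by positivity) (Set.mem_Ici.1 hx)
  rw [stdExp_real_inter, e, stdExp_real measurableSet_Ici hsub, integral_Ici_eq_integral_Ioi]
  rw [integral_exp_neg_Ioi]
  ring_nf

/-- Both integrands are tails of `-log(2X)`, `X` standard exponential, so the left side is
`E(-log(2X))`. -/
lemma integral_gumbel :
    (∫ t in Set.Ioi (0 : ℝ), (1 - Real.exp (-(1 / 2) * Real.exp (-t)))) -
      ∫ t in Set.Ioi (0 : ℝ), Real.exp (-(1 / 2) * Real.exp (-(-t))) =
      Real.eulerMascheroniConstant - Real.log 2 := by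
  have hlog : Set.EqOn (fun t => -Real.log (2 * t) * Real.exp (-t))
      (fun t => -Real.log 2 * Real.exp (-t) - Real.log t * Real.exp (-t)) (Set.Ioi 0) := by
    intro t ht
    have ht' : (0 : ℝ) < t := ht
    simp only [Real.log_mul two_ne_zero ht'.ne']
    ring
  have hi : Integrable (fun t => -Real.log (2 * t)) stdExp := by
    rw [integrable_stdExp_iff, integrableOn_congr_fun hlog measurableSet_Ioi]
    exact (integrableOn_exp_neg.const_mul _).sub integrableOn_log_mul_exp
  have h := integral_eq_integral_tails hi
  rw [integral_stdExp, setIntegral_congr_fun measurableSet_Ioi hlog,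
    integral_sub (integrableOn_exp_neg.const_mul _) integrableOn_log_mul_exp, integral_const_mul,
    integral_log_mul_exp, integral_exp_neg_Ioi] at h
  simp only [stdExp_lt, stdExp_le] at h
  rw [← h]
  simp
  ring

/-! ### The peak of a random odd unimodal sequence -/

namespace OddUnimodalSeq

/-- The rescaled peak. -/
noncomputable def normPeak (n : ℕ) (s : OddUnimodalSeq) : ℝ :=
  s.peak * scale n ^ 2 - Real.log (2 / scale n ^ 2)

lemma normPeak_le_iff {n : ℕ} (hn : 1 ≤ n) (s : OddUnimodalSeq) (v : ℝ) :
    normPeak n s ≤ v ↔ (s.peak : ℝ) ≤ level n v := by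
  have hδ := scale_pos hn
  rw [normPeak, level, le_div_iff₀ (by positivity), sub_le_iff_le_add, add_comm v]

lemma real_normPeak_le {n : ℕ} (hn : 1 ≤ n) (v : ℝ) :
    (uniformMeasure n).real {s | normPeak n s ≤ v} =
      (peakCount (oddIndex (level n v)) n : ℝ) / peakCount n n := by
  simp only [normPeak_le_iff hn]
  exact uniformMeasure_real_peak_le

lemma real_lt_normPeak {n : ℕ} (hn : 1 ≤ n) (v : ℝ) :
    (uniformMeasure n).real {s | v < normPeak n s} =
      1 - (peakCount (oddIndex (level n v)) n : ℝ) / peakCount n n := by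
  have := isProbabilityMeasure_uniformMeasure hn
  rw [← real_normPeak_le hn, ← probReal_compl_eq_one_sub (MeasurableSpace.measurableSet_top)]
  congr 1
  ext s
  simp

lemma integrable_peak {n : ℕ} (hn : 1 ≤ n) :
    Integrable (fun s : OddUnimodalSeq => (s.peak : ℝ)) (uniformMeasure n) := by
  have := isProbabilityMeasure_uniformMeasure hn
  refine Integrable.of_bound (C := n) (measurable_from_top).aestronglyMeasurable ?_
  have h : ∀ᵐ s ∂(uniformMeasure n), s ∈ ofSize n := ae_cond_mem MeasurableSpace.measurableSet_top
  filter_upwards [h] with s hs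
  have hs' : s.left.sum + s.peak + s.right.sum = n := hs
  rw [Real.norm_natCast]
  exact_mod_cast (by omega : s.peak ≤ n)

lemma integrable_normPeak {n : ℕ} (hn : 1 ≤ n) :
    Integrable (normPeak n) (uniformMeasure n) := by
  have := isProbabilityMeasure_uniformMeasure hn
  exact ((integrable_peak hn).mul_const _).sub (integrable_const _)

lemma integral_normPeak {n : ℕ} (hn : 1 ≤ n) : ∫ s, normPeak n s ∂(uniformMeasure n) =
    (∫ s, (s.peak : ℝ) ∂(uniformMeasure n)) * scale n ^ 2 - Real.log (2 / scale n ^ 2) := by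
  have := isProbabilityMeasure_uniformMeasure hn
  simp only [normPeak]
  rw [integral_sub ((integrable_peak hn).mul_const _) (integrable_const _), integral_mul_const]
  simp

lemma tendsto_real_normPeak_le (v : ℝ) :
    Tendsto (fun n => (uniformMeasure n).real {s | normPeak n s ≤ v}) atTop
      (𝓝 (Real.exp (-(1 / 2) * Real.exp (-v)))) := by
  refine (tendsto_peakCount_div v).congr' ?_
  filter_upwards [eventually_ge_atTop 1] with n hn
  rw [real_normPeak_le hn]

/-- Convergence in law alone does not move expectations; each tail integral passes to the limit by
domination with a multiple of `e^(-t)`. -/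
lemma tendsto_integral_normPeak :
    Tendsto (fun n => ∫ s, normPeak n s ∂(uniformMeasure n)) atTop
      (𝓝 (Real.eulerMascheroniConstant - Real.log 2)) := by
  have hup : Tendsto (fun n => ∫ t in Set.Ioi 0, (uniformMeasure n).real {s | t < normPeak n s})
      atTop (𝓝 (∫ t in Set.Ioi 0, (1 - Real.exp (-(1 / 2) * Real.exp (-t))))) := by
    refine tendsto_integral_filter_of_dominated_convergence (fun t => 2 ^ 35 * Real.exp (-t))
      ?_ ?_ (integrableOn_exp_neg.const_mul _) ?_
    · filter_upwards [eventually_ge_atTop 1] with n hn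
      have := isProbabilityMeasure_uniformMeasure hn
      refine (Antitone.measurable fun a b hab => ?_).aestronglyMeasurable
      exact measureReal_mono fun s hs => lt_of_le_of_lt hab hs
    · filter_upwards [eventually_one_sub_peakCount_div_le, eventually_ge_atTop 1] with n h hn
      refine Eventually.of_forall fun t => ?_
      have hδ := scale_pos hn
      rw [Real.norm_of_nonneg measureReal_nonneg, real_lt_normPeak hn]
      refine (h (level n t)).trans (le_of_eq ?_)
      rw [exp_neg_level hn]
      field_simp
    · refine Eventually.of_forall fun t => ?_
      refine ((tendsto_peakCount_div t).const_sub 1).congr' ?_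
      filter_upwards [eventually_ge_atTop 1] with n hn
      rw [real_lt_normPeak hn]
  have hlo : Tendsto (fun n => ∫ t in Set.Ioi 0, (uniformMeasure n).real {s | normPeak n s ≤ -t})
      atTop (𝓝 (∫ t in Set.Ioi 0, Real.exp (-(1 / 2) * Real.exp (-(-t))))) := by
    refine tendsto_integral_filter_of_dominated_convergence (fun t => 2 ^ 44 * Real.exp (-t))
      ?_ ?_ (integrableOn_exp_neg.const_mul _) ?_
    · filter_upwards [eventually_ge_atTop 1] with n hn
      have := isProbabilityMeasure_uniformMeasure hn
      refine (Antitone.measurable fun a b hab => ?_).aestronglyMeasurable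
      exact measureReal_mono fun s hs => le_trans hs (neg_le_neg hab)
    · filter_upwards [eventually_peakCount_div_le, eventually_ge_atTop 1] with n h hn
      filter_upwards [ae_restrict_mem measurableSet_Ioi] with t ht
      have ht' : 0 < t := ht
      have hδ := scale_pos hn
      have e := exp_neg_level hn (-t)
      rw [Real.norm_of_nonneg measureReal_nonneg, real_normPeak_le hn]
      refine (h (level n (-t)) ?_).trans (le_of_eq ?_)
      · rw [level, div_mul_cancel₀ _ (by positivity)]
        linarith
      · rw [Real.exp_neg, neg_neg] at e
        rw [← inv_inv (Real.exp (level n (-t) * scale n ^ 2)), e, Real.exp_neg]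
        field_simp
    · exact Eventually.of_forall fun t => tendsto_real_normPeak_le (-t)
  rw [← integral_gumbel]
  refine (hup.sub hlo).congr' ?_
  filter_upwards [eventually_ge_atTop 1] with n hn
  rw [integral_eq_integral_tails (integrable_normPeak hn)]

end OddUnimodalSeq

/-! ### The limit law and the mean of the peak -/

theorem theorem1p3 (B : ℝ) (hB : B = √6 / Real.pi) :
    (∀ v : ℝ,
      Tendsto
        (fun n : ℕ => (OddUnimodalSeq.uniformMeasure n).real
          {s | ((s.peak : ℝ) - B * √n * Real.log (2 * B * √n)) / (B * √n) ≤ v})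
        atTop (𝓝 (Real.exp (-(1 / 2) * Real.exp (-v))))) ∧
    ∃ ε : ℕ → ℝ, Tendsto ε atTop (𝓝 0) ∧
      ∀ n : ℕ, 1 ≤ n →
        ∫ s, (s.peak : ℝ) ∂(OddUnimodalSeq.uniformMeasure n) =
          B * √n * Real.log (2 * B * √n) +
            B * √n * (Real.eulerMascheroniConstant - Real.log 2) * (1 + ε n) := by
  have hscale : ∀ n : ℕ, 1 ≤ n → B * √n = 1 / scale n ^ 2 := by
    intro n hn
    rw [hB, scale_sq, Real.sqrt_mul (by norm_num), one_div_div]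
    ring
  have hlog : ∀ n : ℕ, 1 ≤ n → Real.log (2 * B * √n) = Real.log (2 / scale n ^ 2) := by
    intro n hn
    rw [mul_assoc, hscale n hn, mul_one_div]
  -- The relative error `ε n` is defined by dividing by this constant, which is negative because `γ
  -- < 2/3 < log 2`.
  have hγ : Real.eulerMascheroniConstant - Real.log 2 ≠ 0 := by
    have h1 := Real.eulerMascheroniConstant_lt_two_thirds
    have h2 := Real.log_two_gt_d9
    exact (by linarith : Real.eulerMascheroniConstant - Real.log 2 < 0).ne
  constructor
  · intro v
    refine (OddUnimodalSeq.tendsto_real_normPeak_le v).congr' ?_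
    filter_upwards [eventually_ge_atTop 1] with n hn
    refine congrArg (OddUnimodalSeq.uniformMeasure n).real (Set.ext fun s => ?_)
    have hδ := scale_pos hn
    simp only [Set.mem_ofPred_eq, OddUnimodalSeq.normPeak, hlog n hn, hscale n hn]
    have e : ((s.peak : ℝ) - 1 / scale n ^ 2 * Real.log (2 / scale n ^ 2)) / (1 / scale n ^ 2) =
        s.peak * scale n ^ 2 - Real.log (2 / scale n ^ 2) := by field_simp
    rw [e]
  · refine ⟨fun n => (∫ s, OddUnimodalSeq.normPeak n s ∂(OddUnimodalSeq.uniformMeasure n)) /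
      (Real.eulerMascheroniConstant - Real.log 2) - 1, ?_, fun n hn => ?_⟩
    · have := (OddUnimodalSeq.tendsto_integral_normPeak.div_const
        (Real.eulerMascheroniConstant - Real.log 2)).sub_const 1
      rwa [div_self hγ, sub_self] at this
    · have hδ := scale_pos hn
      rw [hlog n hn, hscale n hn, add_sub_cancel, mul_assoc, mul_div_cancel₀ _ hγ,
        OddUnimodalSeq.integral_normPeak hn]
      field_simp
      ring
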